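/- All vector spaces are over $\mathbb F_2$ and come with bases; $|\cdot|$ is the Hamming weight. A CSS code is a complex $A = (X \to Q \to Z)$ whose basis elements (cells) are the $X$-checks, the qubits and the $Z$-checks; a cell is adjacent ($\sim$) to the cells in its boundary. Let $\mathfrak w_X, \mathfrak w_Z$ be the maximal weights of $X$- and $Z$-checks, $\mathfrak q_X,\mathfrak q_Z$ the maximal numbers of $X$- and $Z$-checks acting on a qubit, $\mathfrak w=\max(\mathfrak w_X,\mathfrak w_Z)$, and $\mathfrak q$ the maximal total number of checks acting on a qubit. Let $d_X(A)$ (resp. $d_Z(A)$) be the minimal weight of a representative of a nonzero class in $H_1(A)$ (resp. $H^1(A)$), $\infty$ if there is none, and $d(A)=\min(d_X(A),d_Z(A))$. **The 4D Layer Code.** Let $A$ have $\mathfrak w_X,\mathfrak w_Z\ge 1$ and $L^2$ qubits, identified in any way with $[L]^2$. For a check $c$ let $AB(c)$ be the union, over the qubits $(a,b)\sim c$, of the lines $\{a\}\times[L]$ and $[L]\times\{b\}$, as a subgraph of the grid $[L]^2$. Choose line colorings $\eta$ of the $X$-checks with $\chi_X$ colors and of the $Z$-checks with $\chi_Z$ colors,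 such that the graphs $AB(c)$ of distinct checks $c$ of the same type and color share no edge, and plane colorings $\omega$ of the $X$-checks and of the $Z$-checks with values in $[L]$ that are injective on each set of checks of the same type and line color. Let $L_X=\max(\chi_X,L)$, $L_Z=\max(\chi_Z,L)$, and let $R_X,R_Z,R$ be the complexes of the paths (repetition codes) on $L_X,L_Z,L$ vertices. In the cell complex $R_X\otimes R\otimes R\otimes R_Z$ of the grid $[L_X]\times[L]^2\times[L_Z]$ put $$C(x)=\eta(x)\times AB(x)\otimes R_Z+\eta(x)\times[L]^2\times\omega(x),\qquad C(z)=R_X\otimes AB(z)\times\eta(z)+\omega(z)\times[L]^2\times\eta(z),$$ and let $C(q)=R_X\otimes q\otimes R_Z^\top$ for each qubit $q$ ($^\top$ denotes the cocomplex). The 4D Layer Code $C$ is the complex with chain spaces those of $C^X\oplus C^Q\oplus C^Z$, where $C^X=\bigoplus_xC(x)^\top$, $C^Q=\bigoplus_qC(q)$, $C^Z=\bigoplus_zC(z)$ (vertices, edges, faces of $C(x)$ have degrees $2,1,0$), and with differential $\partial^X+\partial^Q+\partial^Z+g^{QX}+g^{ZQ}+p^{ZX}$. Here $g^{QX}$ sends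 a vertex or $\hat z$-edge $|i,q,k^\bullet\rangle$ of $C(x)$ with $q\sim x$ to the cell $|i,q,k^\bullet\rangle$ of $C(q)$, $g^{ZQ}$ sends a cell $|i^\bullet,q,k\rangle$ of $C(q)$ to the sum, over the $z\sim q$ with $\eta(z)=k$, of the cell $|i^\bullet,q,k\rangle$ of $C(z)$, and all other cells are sent to $0$. For $p^{ZX}$, list the common qubits of $x$ and $z$ in lexicographic order as $q_1,\dots,q_{2M}$, let $\gamma_m$ be the path in $[L]^2$ from $q_{2m-1}$ to $q_{2m}$ that moves first along the first axis and then along the second, and $\Gamma_m=\eta(x)\times\gamma_m\times\eta(z)$; $p^{ZX}$ sends a cell of $C(x)$ to the sum over all $z$, $m$ and all occurrences of that cell as a vertex (resp. edge) of $\Gamma_m$ of the edge (resp. vertex) of $C(z)$ that comes next on $\Gamma_m$. **Theorem.** (i) There is an absolute constant $K_0$ such that, if every check of $A$ acts on at least one qubit, such colorings exist for all $\chi_X\ge K_0\,\mathfrak w_X\mathfrak q_XL$ and $\chi_Z\ge K_0\,\mathfrak w_Z\mathfrak q_ZL$. (ii) If $\chi_X=O(\mathfrak w_X\mathfrak q_XL)$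 and $\chi_Z=O(\mathfrak w_Z\mathfrak q_ZL)$, then $$d_X(C)=\Omega\!\left(\frac{L_Z}{\mathfrak w_X\mathfrak w_Z\mathfrak q_Z}\right)d_X(A),\qquad d_Z(C)=\Omega\!\left(\frac{L_X}{\mathfrak w_Z\mathfrak w_X\mathfrak q_X}\right)d_Z(A),$$ where the constants in $\Omega$ depend only on those in $O$. (iii) If $L_X$ and $L_Z$ are boosted to $L_X=\Omega(\mathfrak w_X\mathfrak q_XL)$, $L_Z=\Omega(\mathfrak w_Z\mathfrak q_ZL)$ with $L_X,L_Z=O(\mathfrak w\mathfrak qL)$ (in particular if $L_X,L_Z=\Theta(\mathfrak w\mathfrak qL)$, or if $L_X=\Theta(\mathfrak w_X\mathfrak q_XL)$ and $L_Z=\Theta(\mathfrak w_Z\mathfrak q_ZL)$), then $$d_X(C)=\Omega\!\left(\frac{L}{\mathfrak w_X}\right)d_X(A),\qquad d_Z(C)=\Omega\!\left(\frac{L}{\mathfrak w_Z}\right)d_Z(A),\qquad d(C)=\Omega\!\left(\frac{L}{\mathfrak w}\right)d(A),$$ with constants depending only on those in the hypotheses. -/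

import Mathlib

open scoped Kronecker Matrix NNReal ENNReal

universe u v

set_option linter.unusedSectionVars false

/-! ### Based complexes of length two over the field with two elements (CSS codes) -/

/-- A complex `X → Q → Z` of `𝔽₂`-vector spaces with bases `X` (the `X`-checks), `Q` (the qubits)
and `Z` (the `Z`-checks); the differentials are given by their matrices. -/
structure CSSComplex (X Q Z : Type*) [Fintype Q] where
  /-- the differential from `X`-checks to qubits -/
  d₂ : Matrix Q X (ZMod 2)
  /-- the differential from qubits to `Z`-checks -/
  d₁ : Matrix Z Q (ZMod 2)
  d₁_mul_d₂ : d₁ * d₂ = 0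

namespace CSSComplex

section Parameters

variable {X Q Z : Type*} [Fintype X] [Fintype Q] [Fintype Z] (A : CSSComplex X Q Z)

/-- The qubits on which the `X`-check `x` acts. -/
def suppX (x : X) : Finset Q := Finset.univ.filter fun q => A.d₂ q x ≠ 0

/-- The qubits on which the `Z`-check `z` acts. -/
def suppZ (z : Z) : Finset Q := Finset.univ.filter fun q => A.d₁ z q ≠ 0

/-- The number of `X`-checks acting on the qubit `q`. -/
def degX (q : Q) : ℕ := (Finset.univ.filter fun x => A.d₂ q x ≠ 0).card

/-- The number of `Z`-checks acting on the qubit `q`. -/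
def degZ (q : Q) : ℕ := (Finset.univ.filter fun z => A.d₁ z q ≠ 0).card

/-- Maximal weight of an `X`-check. -/
def wX : ℕ := Finset.univ.sup fun x => (A.suppX x).card

/-- Maximal weight of a `Z`-check. -/
def wZ : ℕ := Finset.univ.sup fun z => (A.suppZ z).card

/-- Maximal number of `X`-checks acting on a qubit. -/
def qX : ℕ := Finset.univ.sup A.degX

/-- Maximal number of `Z`-checks acting on a qubit. -/
def qZ : ℕ := Finset.univ.sup A.degZ

/-- Maximal weight of a check of either type. -/
def w : ℕ := max A.wX A.wZ

/-- Maximal total degree of a qubit. -/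
def q : ℕ := Finset.univ.sup fun r => A.degX r + A.degZ r

/-- The `X`-distance, i.e. the `1`-systolic distance: the least Hamming weight of a `1`-cycle with
nonzero class in `H₁` (equal to `⊤` if `H₁ = 0`). -/
noncomputable def dX : ℕ∞ :=
  ⨅ (l : Q → ZMod 2) (_ : A.d₁ *ᵥ l = 0 ∧ ¬ ∃ s : X → ZMod 2, A.d₂ *ᵥ s = l),
    (hammingNorm l : ℕ∞)

/-- The `Z`-distance, i.e. the `1`-cosystolic distance: the least Hamming weight of a `1`-cocycle
with nonzero class in `H¹` (equal to `⊤` if `H¹ = 0`). -/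
noncomputable def dZ : ℕ∞ :=
  ⨅ (l : Q → ZMod 2) (_ : A.d₂ᵀ *ᵥ l = 0 ∧ ¬ ∃ s : Z → ZMod 2, A.d₁ᵀ *ᵥ s = l),
    (hammingNorm l : ℕ∞)

/-- The code distance. -/
noncomputable def dist : ℕ∞ := min A.dX A.dZ

end Parameters

end CSSComplex

/-! ### Repetition codes, tensor products and the grid -/

namespace LayerCode

/-- Cells of the repetition code on `n` vertices. The vertex `i` is recorded as `2 * i` and the
edge `i + 1/2` as `2 * i + 1` (twice the barycentre), for `i = 0, …, n - 1` and
`i = 0, …, n - 2` respectively. -/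
abbrev RCell (n : ℕ) : Type := Fin (2 * n - 1)

/-- Dimension of a cell of the repetition code: `0` for vertices, `1` for edges. -/
def rdim {n : ℕ} (c : RCell n) : ℕ := c.val % 2

/-- The differential of the repetition code: the edge `i + 1/2` is sent to `i` plus `i + 1`.
Rows are indexed by the target. -/
def repD (n : ℕ) : Matrix (RCell n) (RCell n) (ZMod 2) :=
  Matrix.of fun t s => if rdim s = 1 ∧ (t.val + 1 = s.val ∨ t.val = s.val + 1) then 1 else 0

/-- The differential `∂ ⊗ 1 + 1 ⊗ ∂` of a tensor product of based complexes over `𝔽₂`. -/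
def tensorD {α β : Type*} [DecidableEq α] [DecidableEq β]
    (M : Matrix α α (ZMod 2)) (N : Matrix β β (ZMod 2)) : Matrix (α × β) (α × β) (ZMod 2) :=
  M ⊗ₖ (1 : Matrix β β (ZMod 2)) + (1 : Matrix α α (ZMod 2)) ⊗ₖ N

/-- Cells of the two-dimensional grid `[L]²`. -/
abbrev PlaneCell (L : ℕ) : Type := RCell L × RCell L

/-- Dimension of a cell of `[L]²`. -/
def planeDim {L : ℕ} (c : PlaneCell L) : ℕ := rdim c.1 + rdim c.2

/-- Cells `(i, (a, b), k)` of the four-dimensional grid `[LX] × [L]² × [LZ]`. -/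
abbrev GridCell (LX L LZ : ℕ) : Type := RCell LX × PlaneCell L × RCell LZ

/-- Dimension of a cell of the four-dimensional grid. -/
def gridDim {LX L LZ : ℕ} (c : GridCell LX L LZ) : ℕ := rdim c.1 + planeDim c.2.1 + rdim c.2.2

/-- The differential of the four-dimensional grid complex. -/
def gridD (LX L LZ : ℕ) : Matrix (GridCell LX L LZ) (GridCell LX L LZ) (ZMod 2) :=
  tensorD (repD LX) (tensorD (tensorD (repD L) (repD L)) (repD LZ))

/-- The qubit `q` of `[L]²` as a vertex of the grid complex of `[L]²`, in doubled coordinates. -/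
def qpos {L : ℕ} (q : Fin L × Fin L) : ℕ × ℕ := (2 * q.1.val, 2 * q.2.val)

/-- The cell `c` of `[L]²` lies in the AB graph of the set of qubits `S`, i.e. in the union over
`(a, b) ∈ S` of the lines `a × [L]` and `[L] × b` (with their edges). -/
def InAB {L : ℕ} (S : Finset (Fin L × Fin L)) (c : PlaneCell L) : Prop :=
  ∃ q ∈ S, c.1.val = (qpos q).1 ∨ c.2.val = (qpos q).2

instance {L : ℕ} (S : Finset (Fin L × Fin L)) (c : PlaneCell L) : Decidable (InAB S c) :=
  inferInstanceAs (Decidable (∃ q ∈ S, _))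

/-- A line colouring: AB graphs of distinct checks of the same colour share no edge. -/
def IsLineColoring {L χ : ℕ} {X : Type*} (S : X → Finset (Fin L × Fin L)) (η : X → Fin χ) : Prop :=
  ∀ x x', x ≠ x' → η x = η x' →
    ∀ e : PlaneCell L, planeDim e = 1 → ¬ (InAB (S x) e ∧ InAB (S x') e)

/-- A plane colouring: distinct checks of the same line colour have distinct plane colours. -/
def IsPlaneColoring {L χ : ℕ} {X : Type*} (η : X → Fin χ) (ω : X → Fin L) : Prop :=
  ∀ x x', η x = η x' → ω x = ω x' → x = x'

/-- The choices that enter the construction of a 4D Layer Code of `A`: line and plane colourings of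
the `X`-checks and of the `Z`-checks, with `χX` resp. `χZ` line colours. The qubits of `A` are
the points of `[L]²`. -/
structure Coloring {L : ℕ} {X Z : Type*} [Fintype X] [Fintype Z]
    (A : CSSComplex X (Fin L × Fin L) Z) (χX χZ : ℕ) where
  etaX : X → Fin χX
  etaZ : Z → Fin χZ
  omegaX : X → Fin L
  omegaZ : Z → Fin L
  lineX : IsLineColoring A.suppX etaX
  lineZ : IsLineColoring A.suppZ etaZ
  planeX : IsPlaneColoring etaX omegaX
  planeZ : IsPlaneColoring etaZ omegaZ

/-! ### Defect paths -/

/-- Moving from `u` towards `v` by `t` unit steps, for `t` at most the distance. -/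
def step (u v t : ℕ) : ℕ := if u ≤ v then u + t else u - t

/-- The AB route from `u` to `v`: first along the first axis, then along the second axis. Applied
to doubled coordinates, even times are the vertices and odd times are the edges of the route. -/
def route (u v : ℕ × ℕ) (t : ℕ) : ℕ × ℕ :=
  (step u.1 v.1 (min t (Nat.dist u.1 v.1)), step u.2 v.2 (t - Nat.dist u.1 v.1))

/-- The `L¹` distance, i.e. the length of the AB route. -/
def routeLength (u v : ℕ × ℕ) : ℕ := Nat.dist u.1 v.1 + Nat.dist u.2 v.2

/-- Consecutive disjoint pairs `(q₁, q₂), (q₃, q₄), …` of a list. -/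
def pairUp {α : Type*} : List α → List (α × α)
  | a :: b :: l => (a, b) :: pairUp l
  | _ => []

/-- A finite set of qubits, listed in lexicographic order. -/
def lexList {L : ℕ} (S : Finset (Fin L × Fin L)) : List (Fin L × Fin L) :=
  ((S.map toLex.toEmbedding).sort (· ≤ ·)).map ofLex

/-- The number of pairs `m` and times `s` such that the AB route joining the `m`-th pair of
lexicographically consecutive elements of `S` is at the cell `c` at the (half-integer) time `s / 2`
and at the cell `c'` at the next half-integer time. -/
def defectCount {L : ℕ} (S : Finset (Fin L × Fin L)) (c c' : PlaneCell L) : ℕ :=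
  ((pairUp (lexList S)).map fun uv =>
    ((Finset.range (routeLength (qpos uv.1) (qpos uv.2))).filter fun s =>
      route (qpos uv.1) (qpos uv.2) s = (c.1.val, c.2.val) ∧
      route (qpos uv.1) (qpos uv.2) (s + 1) = (c'.1.val, c'.2.val)).card).sum

/-! ### The 4D Layer Code -/

section Construction

variable {L : ℕ} {X Z : Type*} [Fintype X] [Fintype Z]
  {A : CSSComplex X (Fin L × Fin L) Z} {χX χZ : ℕ}

namespace Coloring

/-- Side length of the grid in the first direction (number of vertices of `R_X`). -/
def LX (_ : Coloring A χX χZ) : ℕ := max χX L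

/-- Side length of the grid in the last direction (number of vertices of `R_Z`). -/
def LZ (_ : Coloring A χX χZ) : ℕ := max χZ L

variable (η : Coloring A χX χZ)

/-- Cells of the ambient four-dimensional grid. -/
abbrev Grid : Type := GridCell η.LX L η.LZ

/-- The cell `c = (i, p, k)` lies in the `X`-check layer
`C(x) = η(x) × AB(x) ⊗ R_Z + η(x) × [L]² × ω(x)`. -/
def InLayerX (x : X) (c : η.Grid) : Prop :=
  c.1.val = 2 * (η.etaX x).val ∧ (InAB (A.suppX x) c.2.1 ∨ c.2.2.val = 2 * (η.omegaX x).val)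

/-- The cell `c = (i, p, k)` lies in the `Z`-check layer
`C(z) = R_X ⊗ AB(z) × η(z) + ω(z) × [L]² × η(z)`. -/
def InLayerZ (z : Z) (c : η.Grid) : Prop :=
  c.2.2.val = 2 * (η.etaZ z).val ∧ (InAB (A.suppZ z) c.2.1 ∨ c.1.val = 2 * (η.omegaZ z).val)

instance (x : X) (c : η.Grid) : Decidable (η.InLayerX x c) :=
  inferInstanceAs (Decidable (_ ∧ _))

instance (z : Z) (c : η.Grid) : Decidable (η.InLayerZ z c) :=
  inferInstanceAs (Decidable (_ ∧ _))

/-- Cells `|x; c⟩` of the direct sum of the `X`-check layers. -/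
abbrev XCell : Type _ := {c : X × η.Grid // η.InLayerX c.1 c.2}

/-- Cells `(q, (i, k))` of the direct sum of the qubit layers `R_X ⊗ q ⊗ R_Zᵀ`. -/
abbrev QCell : Type := (Fin L × Fin L) × (RCell η.LX × RCell η.LZ)

/-- Cells `|c; z⟩` of the direct sum of the `Z`-check layers. -/
abbrev ZCell : Type _ := {c : Z × η.Grid // η.InLayerZ c.1 c.2}

/-- All cells of the Layer Code. -/
abbrev Cell : Type _ := η.XCell ⊕ (η.QCell ⊕ η.ZCell)

/-- Degree of a cell of the Layer Code. The `X`-check layers enter through their cocomplexes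
(vertices in degree `2`, edges in degree `1`, faces in degree `0`), the qubit layers through
`R_X ⊗ R_Zᵀ`, the `Z`-check layers through their complexes. -/
def deg : η.Cell → ℕ
  | .inl c => 2 - gridDim c.1.2
  | .inr (.inl c) => rdim c.2.1 + (1 - rdim c.2.2)
  | .inr (.inr c) => gridDim c.1.2

/-- The gluing map `|x; i, q, k⟩ ↦ |i, q, k⟩` if `q ∼ x` (note that `i = η(x)` in `C(x)`). -/
def gQX : Matrix η.QCell η.XCell (ZMod 2) := Matrix.of fun t s =>
  if t.1 ∈ A.suppX s.1.1 ∧ s.1.2.1 = t.2.1 ∧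
    (s.1.2.2.1.1.val, s.1.2.2.1.2.val) = qpos t.1 ∧ s.1.2.2.2 = t.2.2 then 1 else 0

/-- The gluing map `|i, q, k⟩ ↦ ∑_{z ∼ q} |i, q, k; z⟩ 1{k = η(z)}` (note that `k = η(z)` in
`C(z)`). -/
def gZQ : Matrix η.ZCell η.QCell (ZMod 2) := Matrix.of fun t s =>
  if s.1 ∈ A.suppZ t.1.1 ∧ t.1.2.1 = s.2.1 ∧
    (t.1.2.2.1.1.val, t.1.2.2.1.2.val) = qpos s.1 ∧ t.1.2.2.2 = s.2.2 then 1 else 0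

/-- The defect map: along each defect path `η(x) × γ_m(xz) × η(z)`, a vertex of the path in `C(x)`
is sent to the next edge of the path in `C(z)`, and an edge of the path in `C(x)` to the next
vertex of the path in `C(z)`. Here `γ_m(xz)` is the AB route between the `(2m-1)`-st and the
`2m`-th common qubit of `x` and `z` in lexicographic order. -/
def pZX : Matrix η.ZCell η.XCell (ZMod 2) := Matrix.of fun t s =>
  if t.1.2.1.val = 2 * (η.etaX s.1.1).val ∧ s.1.2.2.2.val = 2 * (η.etaZ t.1.1).val then
    (defectCount (A.suppX s.1.1 ∩ A.suppZ t.1.1) s.1.2.2.1 t.1.2.2.1 : ZMod 2)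
  else 0

variable [DecidableEq X] [DecidableEq Z]

/-- The differential of the direct sum of the cocomplexes of the `X`-check layers. -/
def dXX : Matrix η.XCell η.XCell (ZMod 2) :=
  ((1 : Matrix X X (ZMod 2)) ⊗ₖ (gridD η.LX L η.LZ)ᵀ).submatrix Subtype.val Subtype.val

/-- The differential of the direct sum of the qubit layers `R_X ⊗ R_Zᵀ`. -/
def dQQ : Matrix η.QCell η.QCell (ZMod 2) :=
  (1 : Matrix (Fin L × Fin L) (Fin L × Fin L) (ZMod 2)) ⊗ₖ tensorD (repD η.LX) (repD η.LZ)ᵀ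

/-- The differential of the direct sum of the `Z`-check layers. -/
def dZZ : Matrix η.ZCell η.ZCell (ZMod 2) :=
  ((1 : Matrix Z Z (ZMod 2)) ⊗ₖ gridD η.LX L η.LZ).submatrix Subtype.val Subtype.val

/-- The differential of the Layer Code, on all cells:
`∂ = ∂ˣ + g^{QX} + p^{ZX}` on `C^X`, `∂ = ∂^Q + g^{ZQ}` on `C^Q`, and `∂ = ∂^Z` on `C^Z`. -/
def totalD : Matrix η.Cell η.Cell (ZMod 2) :=
  Matrix.fromBlocks η.dXX 0 (Matrix.fromRows η.gQX η.pZX)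
    (Matrix.fromBlocks η.dQQ 0 η.gZQ η.dZZ)

/-- Cells of degree `s`. -/
abbrev CellOf (s : ℕ) : Type _ := {c : η.Cell // η.deg c = s}

/-- The component of the differential from degree `s + 1` to degree `s`. -/
def diff (s : ℕ) : Matrix (η.CellOf s) (η.CellOf (s + 1)) (ZMod 2) :=
  η.totalD.submatrix Subtype.val Subtype.val

end Coloring

end Construction

/-! ### The differential squares to zero -/

theorem repD_ne_zero {n : ℕ} {t s : RCell n} (h : repD n t s ≠ 0) :
    rdim s = rdim t + 1 := by
  have h' : rdim s = 1 ∧ (t.val + 1 = s.val ∨ t.val = s.val + 1) := by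
    by_contra hc
    exact h (by simp only [repD, Matrix.of_apply, if_neg hc])
  unfold rdim at *
  omega

theorem rdim_le {n : ℕ} (s : RCell n) : rdim s ≤ 1 := by
  unfold rdim
  omega

theorem repD_even {n : ℕ} (t s : RCell n) (h : s.val % 2 = 0) : repD n t s = 0 := by
  by_contra hc
  have := repD_ne_zero hc
  unfold rdim at this
  omega

theorem repD_mul_repD (n : ℕ) : repD n * repD n = 0 := by
  ext t s
  rw [Matrix.mul_apply]
  refine Finset.sum_eq_zero fun r _ => ?_
  by_contra hc
  have h1 := repD_ne_zero (left_ne_zero_of_mul hc)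
  have h2 := repD_ne_zero (right_ne_zero_of_mul hc)
  have := rdim_le s
  omega

theorem tensorD_mul_tensorD {α β : Type*} [Fintype α] [Fintype β] [DecidableEq α] [DecidableEq β]
    (M : Matrix α α (ZMod 2)) (N : Matrix β β (ZMod 2)) (hM : M * M = 0) (hN : N * N = 0) :
    tensorD M N * tensorD M N = 0 := by
  unfold tensorD
  simp only [Matrix.add_mul, Matrix.mul_add, ← Matrix.mul_kronecker_mul, hM, hN, Matrix.mul_one,
    Matrix.one_mul, Matrix.zero_kronecker, Matrix.kronecker_zero, zero_add, add_zero]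
  ext i j
  exact CharTwo.add_self_eq_zero _

theorem gridD_mul_gridD (LX L LZ : ℕ) : gridD LX L LZ * gridD LX L LZ = 0 :=
  tensorD_mul_tensorD _ _ (repD_mul_repD _) (tensorD_mul_tensorD _ _
    (tensorD_mul_tensorD _ _ (repD_mul_repD _) (repD_mul_repD _)) (repD_mul_repD _))

theorem tensorD_apply {α β : Type*} [DecidableEq α] [DecidableEq β]
    (M : Matrix α α (ZMod 2)) (N : Matrix β β (ZMod 2)) (t s : α × β) :
    tensorD M N t s = (if t.2 = s.2 then M t.1 s.1 else 0) + (if t.1 = s.1 then N t.2 s.2 else 0) := by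
  simp [tensorD, Matrix.kroneckerMap_apply, Matrix.one_apply]

theorem tensorD_ne_zero {α β : Type*} [DecidableEq α] [DecidableEq β]
    {M : Matrix α α (ZMod 2)} {N : Matrix β β (ZMod 2)} {t s : α × β} (h : tensorD M N t s ≠ 0) :
    (M t.1 s.1 ≠ 0 ∧ t.2 = s.2) ∨ (t.1 = s.1 ∧ N t.2 s.2 ≠ 0) := by
  by_contra hc
  apply h
  rw [tensorD_apply]
  push Not at hc
  split_ifs with h1 h2 h2
  · have h3 : M t.1 s.1 = 0 := by
      by_contra h4
      exact hc.1 h4 h1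
    rw [h3, hc.2 h2, add_zero]
  · have h3 : M t.1 s.1 = 0 := by
      by_contra h4
      exact hc.1 h4 h1
    rw [h3, add_zero]
  · rw [hc.2 h2, add_zero]
  · rw [add_zero]

theorem planeD_ne_zero {L : ℕ} {t s : PlaneCell L} (h : tensorD (repD L) (repD L) t s ≠ 0) :
    planeDim s = planeDim t + 1 := by
  unfold planeDim
  rcases tensorD_ne_zero h with ⟨h1, h2⟩ | ⟨h1, h2⟩
  · have := repD_ne_zero h1
    rw [h2]
    omega
  · have := repD_ne_zero h2
    rw [h1]
    omega

theorem gridD_ne_zero {LX L LZ : ℕ} {t s : GridCell LX L LZ} (h : gridD LX L LZ t s ≠ 0) :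
    gridDim s = gridDim t + 1 := by
  unfold gridDim
  rcases tensorD_ne_zero h with ⟨h1, h2⟩ | ⟨h1, h2⟩
  · have := repD_ne_zero h1
    rw [h2]
    omega
  · rw [h1]
    rcases tensorD_ne_zero h2 with ⟨h3, h4⟩ | ⟨h3, h4⟩
    · have := planeD_ne_zero h3
      rw [h4]
      omega
    · have := repD_ne_zero h4
      rw [h3]
      omega

theorem sum_subtype_of_support {α : Type*} [Fintype α] (P : α → Prop) [DecidablePred P]
    (f : α → ZMod 2) (h : ∀ a, f a ≠ 0 → P a) : ∑ a : {a // P a}, f a.1 = ∑ a, f a := by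
  rw [← Finset.sum_subtype (Finset.univ.filter P) (by simp) f]
  refine Finset.sum_subset (Finset.filter_subset _ _) fun a _ ha => ?_
  by_contra hc
  exact ha (by simpa using h a hc)

/-- Pairs of the list contribute the whole list if its length is even. -/
theorem sum_pairUp {α : Type*} (f : α → ZMod 2) :
    ∀ l : List α, Even l.length →
      ((pairUp l).map fun uv => f uv.1 + f uv.2).sum = (l.map f).sum
  | [], _ => by simp [pairUp]
  | [a], h => by simp at h
  | a :: b :: l, h => by
    have hl : Even l.length := by
      simp only [List.length_cons] at h
      grind
    simp [pairUp, sum_pairUp f l hl, add_assoc]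

theorem sum_lexList {L : ℕ} (S : Finset (Fin L × Fin L)) (f : Fin L × Fin L → ZMod 2) :
    ((lexList S).map f).sum = ∑ q ∈ S, f q := by
  have h : ((lexList S).map f).sum =
      ((((S.map toLex.toEmbedding).sort (· ≤ ·)).map (fun x => f (ofLex x)))).sum := by
    simp [lexList, Function.comp_def]
  rw [h, ← List.sum_toFinset _ (Finset.sort_nodup _ _), Finset.sort_toFinset]
  simp

theorem length_lexList {L : ℕ} (S : Finset (Fin L × Fin L)) : (lexList S).length = S.card := by
  simp [lexList]

theorem step_spec (u v t : ℕ) : (u ≤ v ∧ step u v t = u + t) ∨ (v < u ∧ step u v t = u - t) := by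
  unfold step
  split_ifs <;> omega

theorem route_bounds {L : ℕ} (u v : Fin L × Fin L) (t : ℕ)
    (ht : t ≤ routeLength (qpos u) (qpos v)) :
    (route (qpos u) (qpos v) t).1 < 2 * L - 1 ∧ (route (qpos u) (qpos v) t).2 < 2 * L - 1 := by
  have := u.1.2; have := u.2.2; have := v.1.2; have := v.2.2
  simp only [route, routeLength, qpos, Nat.dist] at *
  constructor
  · rcases step_spec (2 * u.1.val) (2 * v.1.val)
      (min t (2 * u.1.val - 2 * v.1.val + (2 * v.1.val - 2 * u.1.val))) with h | h <;> omega
  · rcases step_spec (2 * u.2.val) (2 * v.2.val)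
      (t - (2 * u.1.val - 2 * v.1.val + (2 * v.1.val - 2 * u.1.val))) with h | h <;> omega

/-- The `t`-th cell of the route. -/
def routeCell {L : ℕ} (u v : Fin L × Fin L) (t : ℕ)
    (ht : t ≤ routeLength (qpos u) (qpos v)) : PlaneCell L :=
  (⟨_, (route_bounds u v t ht).1⟩, ⟨_, (route_bounds u v t ht).2⟩)

/-- `e` is an edge coordinate with end points `x` and `y`. -/
def IsEdgeBetween (x e y : ℕ) : Prop :=
  e % 2 = 1 ∧ ((x + 1 = e ∧ y = e + 1) ∨ (x = e + 1 ∧ y + 1 = e))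

theorem step_isEdge (u v s : ℕ) (hu : u % 2 = 0) (hs : 2 * s + 2 ≤ Nat.dist u v) :
    IsEdgeBetween (step u v (2 * s)) (step u v (2 * s + 1)) (step u v (2 * s + 2)) := by
  unfold IsEdgeBetween step
  unfold Nat.dist at hs
  by_cases h : u ≤ v
  · simp only [h, if_true]
    omega
  · simp only [h, if_false]
    omega

theorem step_zero (u v : ℕ) : step u v 0 = u := by
  unfold step
  split_ifs <;> omega

theorem step_dist (u v : ℕ) : step u v (Nat.dist u v) = v := by
  unfold step Nat.dist
  split_ifs <;> omega

/-- An edge of the route and its two end points. -/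
theorem route_spec (u v : ℕ × ℕ) (hu1 : u.1 % 2 = 0) (hu2 : u.2 % 2 = 0) (hv1 : v.1 % 2 = 0)
    (t : ℕ) (ht : 2 * t + 2 ≤ routeLength u v) :
    (IsEdgeBetween (route u v (2 * t)).1 (route u v (2 * t + 1)).1 (route u v (2 * t + 2)).1 ∧
      (route u v (2 * t)).2 = (route u v (2 * t + 1)).2 ∧
      (route u v (2 * t + 2)).2 = (route u v (2 * t + 1)).2 ∧ (route u v (2 * t + 1)).2 % 2 = 0) ∨
    (IsEdgeBetween (route u v (2 * t)).2 (route u v (2 * t + 1)).2 (route u v (2 * t + 2)).2 ∧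
      (route u v (2 * t)).1 = (route u v (2 * t + 1)).1 ∧
      (route u v (2 * t + 2)).1 = (route u v (2 * t + 1)).1 ∧
      (route u v (2 * t + 1)).1 % 2 = 0) := by
  unfold routeLength at ht
  have hd : Nat.dist u.1 v.1 % 2 = 0 := by
    unfold Nat.dist
    omega
  unfold route
  by_cases h : 2 * t + 2 ≤ Nat.dist u.1 v.1
  · left
    rw [min_eq_left (by omega), min_eq_left (by omega), min_eq_left (by omega),
      Nat.sub_eq_zero_of_le (by omega : 2 * t ≤ _),
      Nat.sub_eq_zero_of_le (by omega : 2 * t + 1 ≤ _), Nat.sub_eq_zero_of_le h, step_zero]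
    exact ⟨step_isEdge _ _ _ hu1 h, rfl, rfl, hu2⟩
  · right
    rw [min_eq_right (by omega), min_eq_right (by omega), min_eq_right (by omega), step_dist]
    obtain ⟨s, hs⟩ : ∃ s, 2 * t = Nat.dist u.1 v.1 + 2 * s :=
      ⟨(2 * t - Nat.dist u.1 v.1) / 2, by omega⟩
    have h0 : 2 * t - Nat.dist u.1 v.1 = 2 * s := by omega
    have h1 : 2 * t + 1 - Nat.dist u.1 v.1 = 2 * s + 1 := by omega
    have h2 : 2 * t + 2 - Nat.dist u.1 v.1 = 2 * s + 2 := by omega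
    rw [h0, h1, h2]
    exact ⟨step_isEdge _ _ _ hu2 (by omega), rfl, rfl, hv1⟩

theorem repD_edge {n : ℕ} (a e : RCell n) (x y : ℕ) (h : IsEdgeBetween x e.val y) :
    repD n a e = (if a.val = x then 1 else 0) + (if a.val = y then 1 else 0) := by
  unfold IsEdgeBetween at h
  by_cases h1 : rdim e = 1 ∧ (a.val + 1 = e.val ∨ a.val = e.val + 1)
  · simp only [repD, Matrix.of_apply, if_pos h1]
    split_ifs <;> first | omega | rfl
  · simp only [repD, Matrix.of_apply, if_neg h1]
    unfold rdim at h1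
    split_ifs <;> first | omega | rfl

theorem planeD_routeCell {L : ℕ} (u v : Fin L × Fin L) (t : ℕ)
    (ht : 2 * t + 2 ≤ routeLength (qpos u) (qpos v)) (c : PlaneCell L) :
    tensorD (repD L) (repD L) c (routeCell u v (2 * t + 1) (by omega)) =
      (if c = routeCell u v (2 * t) (by omega) then 1 else 0) +
      (if c = routeCell u v (2 * t + 2) ht then 1 else 0) := by
  have h := route_spec (qpos u) (qpos v) (by simp [qpos]) (by simp [qpos]) (by simp [qpos]) t ht
  obtain ⟨a, b⟩ := c
  rw [tensorD_apply]
  rcases h with ⟨h1, h2, h3, h4⟩ | ⟨h1, h2, h3, h4⟩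
  · rw [repD_edge a (routeCell u v (2 * t + 1) (by omega)).1 _ _ h1,
      repD_even _ (routeCell u v (2 * t + 1) (by omega)).2 h4, ite_self, add_zero]
    simp only [routeCell, Prod.mk.injEq, Fin.ext_iff]
    rw [h2, h3]
    by_cases hb : b.val = (route (qpos u) (qpos v) (2 * t + 1)).2 <;> simp [hb]
  · rw [repD_edge b (routeCell u v (2 * t + 1) (by omega)).2 _ _ h1,
      repD_even _ (routeCell u v (2 * t + 1) (by omega)).1 h4, ite_self, zero_add]
    simp only [routeCell, Prod.mk.injEq, Fin.ext_iff]
    rw [h2, h3]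
    by_cases hb : a.val = (route (qpos u) (qpos v) (2 * t + 1)).1 <;> simp [hb]

theorem routeLength_even {L : ℕ} (u v : Fin L × Fin L) :
    ∃ n, routeLength (qpos u) (qpos v) = 2 * n := by
  refine ⟨routeLength (qpos u) (qpos v) / 2, ?_⟩
  unfold routeLength qpos Nat.dist
  omega

theorem route_even {L : ℕ} (u v : Fin L × Fin L) (t : ℕ) :
    (route (qpos u) (qpos v) (2 * t)).1 % 2 = 0 ∧ (route (qpos u) (qpos v) (2 * t)).2 % 2 = 0 := by
  simp only [route, qpos, Nat.dist]
  constructor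
  · rcases step_spec (2 * u.1.val) (2 * v.1.val)
      (min (2 * t) (2 * u.1.val - 2 * v.1.val + (2 * v.1.val - 2 * u.1.val))) with h | h <;> omega
  · rcases step_spec (2 * u.2.val) (2 * v.2.val)
      (2 * t - (2 * u.1.val - 2 * v.1.val + (2 * v.1.val - 2 * u.1.val))) with h | h <;> omega

theorem route_zero (u v : ℕ × ℕ) : route u v 0 = u := by
  simp [route, step_zero]

theorem route_length (u v : ℕ × ℕ) : route u v (routeLength u v) = v := by
  simp [route, routeLength, step_dist]

/-- Indicator of the route from `u` to `v` being at the cell `c` at time `s / 2`. -/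
def routeInd {L : ℕ} (u v : Fin L × Fin L) (s : ℕ) (c : PlaneCell L) : ZMod 2 :=
  if route (qpos u) (qpos v) s = (c.1.val, c.2.val) then 1 else 0

theorem routeInd_eq {L : ℕ} (u v : Fin L × Fin L) (s : ℕ)
    (hs : s ≤ routeLength (qpos u) (qpos v)) (c : PlaneCell L) :
    routeInd u v s c = if c = routeCell u v s hs then 1 else 0 := by
  unfold routeInd
  congr 1
  obtain ⟨a, b⟩ := c
  simp only [routeCell, Prod.ext_iff, Fin.ext_iff, eq_iff_iff]
  constructor <;> rintro ⟨h1, h2⟩ <;> exact ⟨h1.symm, h2.symm⟩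

theorem sum_planeD_routeInd {L : ℕ} (u v : Fin L × Fin L) (s : ℕ)
    (hs : s ≤ routeLength (qpos u) (qpos v)) (c : PlaneCell L) :
    ∑ e, tensorD (repD L) (repD L) c e * routeInd u v s e =
      tensorD (repD L) (repD L) c (routeCell u v s hs) := by
  simp [routeInd_eq u v s hs]

theorem boundary_even {L : ℕ} (u v : Fin L × Fin L) (t : ℕ)
    (hs : 2 * t ≤ routeLength (qpos u) (qpos v)) (c : PlaneCell L) :
    ∑ e, tensorD (repD L) (repD L) c e * routeInd u v (2 * t) e = 0 := by
  rw [sum_planeD_routeInd u v _ hs, tensorD_apply,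
    repD_even _ (routeCell u v (2 * t) hs).1 (route_even u v t).1,
    repD_even _ (routeCell u v (2 * t) hs).2 (route_even u v t).2, ite_self, ite_self, add_zero]

theorem boundary_odd {L : ℕ} (u v : Fin L × Fin L) (t : ℕ)
    (hs : 2 * t + 2 ≤ routeLength (qpos u) (qpos v)) (c : PlaneCell L) :
    ∑ e, tensorD (repD L) (repD L) c e * routeInd u v (2 * t + 1) e =
      routeInd u v (2 * t) c + routeInd u v (2 * t + 2) c := by
  rw [sum_planeD_routeInd u v _ (by omega), planeD_routeCell u v t hs,
    routeInd_eq u v _ (by omega), routeInd_eq u v _ hs]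

theorem sum_range_two_mul (f : ℕ → ZMod 2) (n : ℕ) :
    ∑ s ∈ Finset.range (2 * n), f s = ∑ t ∈ Finset.range n, (f (2 * t) + f (2 * t + 1)) := by
  induction n with
  | zero => simp
  | succ n ih =>
    rw [Finset.sum_range_succ, ← ih, show 2 * (n + 1) = 2 * n + 1 + 1 by ring,
      Finset.sum_range_succ, Finset.sum_range_succ, add_assoc]

theorem sum_telescope (f : ℕ → ZMod 2) (n : ℕ) :
    ∑ t ∈ Finset.range n, (f t + f (t + 1)) = f 0 + f n := by
  induction n with
  | zero => simp [CharTwo.add_self_eq_zero]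
  | succ n ih =>
    rw [Finset.sum_range_succ, ih]
    linear_combination CharTwo.add_self_eq_zero (f n)

/-- Contribution of one route to the defect map. -/
def routeCount {L : ℕ} (u v : Fin L × Fin L) (c c' : PlaneCell L) : ZMod 2 :=
  ∑ s ∈ Finset.range (routeLength (qpos u) (qpos v)), routeInd u v s c * routeInd u v (s + 1) c'

theorem routeCount_compat {L : ℕ} (u v : Fin L × Fin L) (c c' : PlaneCell L) :
    ∑ e, tensorD (repD L) (repD L) c e * routeCount u v e c' +
      ∑ e, tensorD (repD L) (repD L) c' e * routeCount u v c e =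
    routeInd u v 0 c * routeInd u v 0 c' +
      routeInd u v (routeLength (qpos u) (qpos v)) c *
        routeInd u v (routeLength (qpos u) (qpos v)) c' := by
  obtain ⟨n, hn⟩ := routeLength_even u v
  have h1 : ∑ e, tensorD (repD L) (repD L) c e * routeCount u v e c' =
      ∑ s ∈ Finset.range (2 * n), routeInd u v (s + 1) c' *
        ∑ e, tensorD (repD L) (repD L) c e * routeInd u v s e := by
    simp only [routeCount, Finset.mul_sum, hn]
    rw [Finset.sum_comm]
    refine Finset.sum_congr rfl fun s _ => Finset.sum_congr rfl fun e _ => by ring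
  have h2 : ∑ e, tensorD (repD L) (repD L) c' e * routeCount u v c e =
      ∑ s ∈ Finset.range (2 * n), routeInd u v s c *
        ∑ e, tensorD (repD L) (repD L) c' e * routeInd u v (s + 1) e := by
    simp only [routeCount, Finset.mul_sum, hn]
    rw [Finset.sum_comm]
    refine Finset.sum_congr rfl fun s _ => Finset.sum_congr rfl fun e _ => by ring
  rw [h1, h2, ← Finset.sum_add_distrib, sum_range_two_mul, hn,
    ← sum_telescope (fun t => routeInd u v (2 * t) c * routeInd u v (2 * t) c')]
  refine Finset.sum_congr rfl fun t ht => ?_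
  have ht' := Finset.mem_range.1 ht
  rw [boundary_even u v t (by omega), boundary_odd u v t (by omega),
    boundary_odd u v t (by omega)]
  rw [show 2 * t + 1 + 1 = 2 * (t + 1) by ring, boundary_even u v (t + 1) (by omega)]
  linear_combination CharTwo.add_self_eq_zero (routeInd u v (2 * t) c * routeInd u v (2 * (t + 1)) c')

theorem defectCount_eq {L : ℕ} (S : Finset (Fin L × Fin L)) (c c' : PlaneCell L) :
    (defectCount S c c' : ZMod 2) =
      ((pairUp (lexList S)).map fun uv => routeCount uv.1 uv.2 c c').sum := by
  unfold defectCount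
  generalize pairUp (lexList S) = l
  induction l with
  | nil => simp
  | cons p l ih =>
    rw [List.map_cons, List.sum_cons, List.map_cons, List.sum_cons, Nat.cast_add, ih]
    congr 1
    rw [Finset.card_filter, routeCount]
    push_cast
    refine Finset.sum_congr rfl fun s _ => ?_
    unfold routeInd
    split_ifs <;> simp_all

theorem mul_list_sum {α : Type*} (l : List α) {β : Type*} [Fintype β] (g : β → ZMod 2)
    (f : α → β → ZMod 2) :
    ∑ e, g e * (l.map fun p => f p e).sum = (l.map fun p => ∑ e, g e * f p e).sum := by
  induction l with
  | nil => simp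
  | cons p l ih => simp [mul_add, Finset.sum_add_distrib, ih]

theorem defectCount_compat {L : ℕ} (S : Finset (Fin L × Fin L)) (hS : Even S.card)
    (c c' : PlaneCell L) :
    ∑ e, tensorD (repD L) (repD L) c e * (defectCount S e c' : ZMod 2) +
      ∑ e, tensorD (repD L) (repD L) c' e * (defectCount S c e : ZMod 2) =
    ∑ q ∈ S, if qpos q = (c.1.val, c.2.val) ∧ qpos q = (c'.1.val, c'.2.val) then 1 else 0 := by
  simp only [defectCount_eq]
  rw [mul_list_sum (pairUp (lexList S)) _ (fun uv e => routeCount uv.1 uv.2 e c'),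
    mul_list_sum (pairUp (lexList S)) _ (fun uv e => routeCount uv.1 uv.2 c e),
    ← List.sum_map_add, ← sum_lexList, ← sum_pairUp _ (lexList S) (by rwa [length_lexList])]
  congr 1
  refine List.map_congr_left fun uv _ => ?_
  rw [routeCount_compat]
  unfold routeInd
  rw [route_zero, route_length]
  have key : ∀ r a b : ℕ × ℕ, (if r = a then (1 : ZMod 2) else 0) * (if r = b then 1 else 0) =
      if r = a ∧ r = b then 1 else 0 := by
    intro r a b
    by_cases h1 : r = a
    · by_cases h2 : r = b
      · rw [if_pos h1, if_pos h2, if_pos ⟨h1, h2⟩, one_mul]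
      · rw [if_neg h2, if_neg (fun h : r = a ∧ r = b => h2 h.2), mul_zero]
    · rw [if_neg h1, if_neg (fun h : r = a ∧ r = b => h1 h.1), zero_mul]
  rw [key, key]

theorem mem_of_mem_pairUp {α : Type*} (p : α × α) :
    ∀ l : List α, p ∈ pairUp l → p.1 ∈ l ∧ p.2 ∈ l
  | [], h => by simp [pairUp] at h
  | [a], h => by simp [pairUp] at h
  | a :: b :: l, h => by
    rw [pairUp, List.mem_cons] at h
    rcases h with rfl | h
    · simp
    · have := mem_of_mem_pairUp p l h
      simp [this]

theorem route_mem (u v : ℕ × ℕ) (s : ℕ) : (route u v s).1 = v.1 ∨ (route u v s).2 = u.2 := by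
  unfold route
  by_cases h : s ≤ Nat.dist u.1 v.1
  · right
    simp [Nat.sub_eq_zero_of_le h, step_zero]
  · left
    simp [min_eq_right (by omega : Nat.dist u.1 v.1 ≤ s), step_dist]

theorem defectCount_mem {L : ℕ} {S : Finset (Fin L × Fin L)} {c c' : PlaneCell L}
    (h : (defectCount S c c' : ZMod 2) ≠ 0) : InAB S c ∧ InAB S c' := by
  have h0 : defectCount S c c' ≠ 0 := fun h1 => h (by rw [h1, Nat.cast_zero])
  unfold defectCount at h0
  rw [ne_eq, List.sum_eq_zero_iff] at h0
  push Not at h0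
  obtain ⟨n, hn, hn0⟩ := h0
  obtain ⟨p, hp, rfl⟩ := List.mem_map.1 hn
  obtain ⟨s, hs⟩ := Finset.card_ne_zero.1 hn0
  obtain ⟨-, h1, h2⟩ := Finset.mem_filter.1 hs
  have hS : ∀ q ∈ lexList S, q ∈ S := by
    intro q hq
    simpa [lexList] using hq
  have hp' := mem_of_mem_pairUp p _ hp
  have hu := hS _ hp'.1
  have hv := hS _ hp'.2
  constructor
  · have := route_mem (qpos p.1) (qpos p.2) s
    rw [h1] at this
    rcases this with h | h
    · exact ⟨_, hv, Or.inl h⟩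
    · exact ⟨_, hu, Or.inr h⟩
  · have := route_mem (qpos p.1) (qpos p.2) (s + 1)
    rw [h2] at this
    rcases this with h | h
    · exact ⟨_, hv, Or.inl h⟩
    · exact ⟨_, hu, Or.inr h⟩

theorem InAB.mono {L : ℕ} {S T : Finset (Fin L × Fin L)} (h : S ⊆ T) {c : PlaneCell L}
    (hc : InAB S c) : InAB T c := by
  obtain ⟨q, hq, h1⟩ := hc
  exact ⟨q, h hq, h1⟩

theorem defectCount_dim {L : ℕ} {S : Finset (Fin L × Fin L)} {c c' : PlaneCell L}
    (h : (defectCount S c c' : ZMod 2) ≠ 0) : planeDim c + planeDim c' = 1 := by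
  have h0 : defectCount S c c' ≠ 0 := fun h1 => h (by rw [h1, Nat.cast_zero])
  unfold defectCount at h0
  rw [ne_eq, List.sum_eq_zero_iff] at h0
  push Not at h0
  obtain ⟨n, hn, hn0⟩ := h0
  obtain ⟨⟨u, v⟩, hp, rfl⟩ := List.mem_map.1 hn
  obtain ⟨s, hs⟩ := Finset.card_ne_zero.1 hn0
  obtain ⟨hs', h1, h2⟩ := Finset.mem_filter.1 hs
  have hlt := Finset.mem_range.1 hs'
  obtain ⟨n, hn⟩ := routeLength_even u v
  simp only at hlt h1 h2
  have hev : ∀ t, 2 * t + 2 ≤ routeLength (qpos u) (qpos v) →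
      (route (qpos u) (qpos v) (2 * t + 1)).1 % 2 + (route (qpos u) (qpos v) (2 * t + 1)).2 % 2
        = 1 := by
    intro t ht
    rcases route_spec (qpos u) (qpos v) (by simp [qpos]) (by simp [qpos]) (by simp [qpos]) t ht with
      ⟨h1, h2, h3, h4⟩ | ⟨h1, h2, h3, h4⟩
    · have := h1.1
      omega
    · have := h1.1
      omega
  unfold planeDim rdim
  rcases Nat.even_or_odd' s with ⟨t, rfl | rfl⟩
  · have e1 := route_even u v t
    have e2 := hev t (by omega)
    rw [h1] at e1
    rw [h2] at e2
    simp only at e1 e2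
    omega
  · have e1 := route_even u v (t + 1)
    have e2 := hev t (by omega)
    rw [show 2 * (t + 1) = 2 * t + 1 + 1 by ring, h2] at e1
    rw [h1] at e2
    simp only at e1 e2
    omega

theorem repD_odd {n : ℕ} {t s : RCell n} (h : repD n t s ≠ 0) : s.val % 2 = 1 := by
  by_contra hc
  exact h (repD_even _ _ (by omega))

theorem InAB.facet {L : ℕ} {S : Finset (Fin L × Fin L)} {t s : PlaneCell L}
    (h : tensorD (repD L) (repD L) t s ≠ 0) (hs : InAB S s) : InAB S t := by
  obtain ⟨q, hq, h1⟩ := hs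
  refine ⟨q, hq, ?_⟩
  simp only [qpos] at *
  rcases tensorD_ne_zero h with ⟨h2, h3⟩ | ⟨h2, h3⟩
  · have := repD_odd h2
    rw [h3]
    omega
  · have := repD_odd h3
    rw [h2]
    omega

section Compatibility

variable {L : ℕ} {X Z : Type*} [Fintype X] [Fintype Z]
  {A : CSSComplex X (Fin L × Fin L) Z} {χX χZ : ℕ}

namespace Coloring

variable (η : Coloring A χX χZ)

theorem even_common (x : X) (z : Z) : Even (A.suppX x ∩ A.suppZ z).card := by
  have h := congrFun (congrFun A.d₁_mul_d₂ z) x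
  rw [Matrix.mul_apply, Matrix.zero_apply] at h
  have h1 : ∀ a b : ZMod 2, a * b = if b ≠ 0 ∧ a ≠ 0 then 1 else 0 := by decide
  simp only [h1, Finset.sum_boole] at h
  rw [ZMod.natCast_eq_zero_iff_even] at h
  convert h using 2
  ext q
  simp [CSSComplex.suppX, CSSComplex.suppZ]

variable {η} in
theorem InLayerX.facet {x : X} {t s : η.Grid} (h : gridD _ _ _ t s ≠ 0)
    (hs : η.InLayerX x s) : η.InLayerX x t := by
  obtain ⟨h1, h2⟩ := hs
  rcases tensorD_ne_zero h with ⟨h3, h4⟩ | ⟨h3, h4⟩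
  · have := repD_odd h3
    omega
  · refine ⟨by rw [h3]; exact h1, ?_⟩
    rcases tensorD_ne_zero h4 with ⟨h5, h6⟩ | ⟨h5, h6⟩
    · rcases h2 with h2 | h2
      · exact Or.inl (h2.facet h5)
      · exact Or.inr (by rw [h6]; exact h2)
    · rcases h2 with h2 | h2
      · exact Or.inl (by rw [h5]; exact h2)
      · have := repD_odd h6
        omega

variable {η} in
theorem InLayerZ.facet {z : Z} {t s : η.Grid} (h : gridD _ _ _ t s ≠ 0)
    (hs : η.InLayerZ z s) : η.InLayerZ z t := by
  obtain ⟨h1, h2⟩ := hs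
  rcases tensorD_ne_zero h with ⟨h3, h4⟩ | ⟨h3, h4⟩
  · refine ⟨by rw [h4]; exact h1, ?_⟩
    rcases h2 with h2 | h2
    · exact Or.inl (by rw [h4]; exact h2)
    · have := repD_odd h3
      omega
  · rcases tensorD_ne_zero h4 with ⟨h5, h6⟩ | ⟨h5, h6⟩
    · refine ⟨by rw [h6]; exact h1, ?_⟩
      rcases h2 with h2 | h2
      · exact Or.inl (h2.facet h5)
      · exact Or.inr (by rw [h3]; exact h2)
    · have := repD_odd h6
      omega

variable [DecidableEq X] [DecidableEq Z]

theorem dXX_apply (t s : η.XCell) :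
    η.dXX t s = if t.1.1 = s.1.1 then gridD _ _ _ s.1.2 t.1.2 else 0 := by
  simp [dXX, Matrix.one_apply]

theorem dZZ_apply (t s : η.ZCell) :
    η.dZZ t s = if t.1.1 = s.1.1 then gridD _ _ _ t.1.2 s.1.2 else 0 := by
  simp [dZZ, Matrix.one_apply]

theorem dQQ_apply (t s : η.QCell) :
    η.dQQ t s = if t.1 = s.1 then tensorD (repD η.LX) (repD η.LZ)ᵀ t.2 s.2 else 0 := by
  simp [dQQ, Matrix.one_apply]

theorem dZZ_mul_dZZ : η.dZZ * η.dZZ = 0 := by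
  ext t s
  have h : ((1 : Matrix Z Z (ZMod 2)) ⊗ₖ gridD η.LX L η.LZ) *
      ((1 : Matrix Z Z (ZMod 2)) ⊗ₖ gridD η.LX L η.LZ) = 0 := by
    rw [← Matrix.mul_kronecker_mul, gridD_mul_gridD, Matrix.kronecker_zero]
  have h' := congrFun (congrFun h t.1) s.1
  rw [Matrix.mul_apply, Matrix.zero_apply] at h' ⊢
  refine Eq.trans (sum_subtype_of_support _ (fun r =>
    ((1 : Matrix Z Z (ZMod 2)) ⊗ₖ gridD η.LX L η.LZ) t.1 r *
    ((1 : Matrix Z Z (ZMod 2)) ⊗ₖ gridD η.LX L η.LZ) r s.1) fun r hr => ?_) h'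
  have hr' := right_ne_zero_of_mul hr
  simp only [Matrix.kroneckerMap_apply] at hr'
  have h1 : r.1 = s.1.1 := by
    by_contra hc
    exact hr' (by rw [Matrix.one_apply_ne hc, zero_mul])
  rw [h1]
  exact InLayerZ.facet (right_ne_zero_of_mul hr') s.2

theorem dXX_mul_dXX : η.dXX * η.dXX = 0 := by
  ext t s
  have h : ((1 : Matrix X X (ZMod 2)) ⊗ₖ (gridD η.LX L η.LZ)ᵀ) *
      ((1 : Matrix X X (ZMod 2)) ⊗ₖ (gridD η.LX L η.LZ)ᵀ) = 0 := by
    rw [← Matrix.mul_kronecker_mul, ← Matrix.transpose_mul, gridD_mul_gridD,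
      Matrix.transpose_zero, Matrix.kronecker_zero]
  have h' := congrFun (congrFun h t.1) s.1
  rw [Matrix.mul_apply, Matrix.zero_apply] at h' ⊢
  refine Eq.trans (sum_subtype_of_support _ (fun r =>
    ((1 : Matrix X X (ZMod 2)) ⊗ₖ (gridD η.LX L η.LZ)ᵀ) t.1 r *
    ((1 : Matrix X X (ZMod 2)) ⊗ₖ (gridD η.LX L η.LZ)ᵀ) r s.1) fun r hr => ?_) h'
  have hr' := left_ne_zero_of_mul hr
  simp only [Matrix.kroneckerMap_apply] at hr'
  have h1 : t.1.1 = r.1 := by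
    by_contra hc
    exact hr' (by rw [Matrix.one_apply_ne hc, zero_mul])
  rw [← h1]
  exact InLayerX.facet (right_ne_zero_of_mul hr') t.2

theorem dQQ_mul_dQQ : η.dQQ * η.dQQ = 0 := by
  unfold dQQ
  rw [← Matrix.mul_kronecker_mul, tensorD_mul_tensorD _ _ (repD_mul_repD _)
    (by rw [← Matrix.transpose_mul, repD_mul_repD, Matrix.transpose_zero]), Matrix.kronecker_zero]

/-- The vertex of the grid complex at the qubit `q`. -/
def qcell (q : Fin L × Fin L) : PlaneCell L :=
  (⟨2 * q.1.val, by have := q.1.2; omega⟩, ⟨2 * q.2.val, by have := q.2.2; omega⟩)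

theorem qpos_eq_iff (q : Fin L × Fin L) (c : PlaneCell L) :
    (c.1.val, c.2.val) = qpos q ↔ c = qcell q := by
  obtain ⟨a, b⟩ := c
  simp [qpos, qcell, Fin.ext_iff]

theorem planeD_qcell (q : Fin L × Fin L) (c : PlaneCell L) :
    tensorD (repD L) (repD L) c (qcell q) = 0 := by
  rw [tensorD_apply, repD_even _ _ (by simp [qcell]), repD_even _ _ (by simp [qcell])]
  simp

theorem gridD_apply {LX L LZ : ℕ} (t s : GridCell LX L LZ) :
    gridD LX L LZ t s = (if t.2.1 = s.2.1 ∧ t.2.2 = s.2.2 then repD LX t.1 s.1 else 0) +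
      ((if t.1 = s.1 ∧ t.2.2 = s.2.2 then tensorD (repD L) (repD L) t.2.1 s.2.1 else 0) +
      (if t.1 = s.1 ∧ t.2.1 = s.2.1 then repD LZ t.2.2 s.2.2 else 0)) := by
  obtain ⟨i, p, k⟩ := t
  obtain ⟨i', p', k'⟩ := s
  unfold gridD
  rw [tensorD_apply, tensorD_apply]
  simp only [Prod.mk.injEq, ite_and]
  split_ifs <;> simp

theorem inLayerX_qcell {x : X} {q : Fin L × Fin L} (hq : q ∈ A.suppX x) (i : RCell η.LX)
    (hi : i.val = 2 * (η.etaX x).val) (k : RCell η.LZ) : η.InLayerX x (i, qcell q, k) :=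
  ⟨hi, Or.inl ⟨q, hq, Or.inl rfl⟩⟩

theorem inLayerZ_qcell {z : Z} {q : Fin L × Fin L} (hq : q ∈ A.suppZ z) (i : RCell η.LX)
    (k : RCell η.LZ) (hk : k.val = 2 * (η.etaZ z).val) : η.InLayerZ z (i, qcell q, k) :=
  ⟨hk, Or.inl ⟨q, hq, Or.inl rfl⟩⟩

theorem gQX_mul_dXX (t : η.QCell) (s : η.XCell) :
    (η.gQX * η.dXX) t s = if t.1 ∈ A.suppX s.1.1 ∧ t.2.1 = s.1.2.1 then
      gridD _ _ _ s.1.2 (t.2.1, qcell t.1, t.2.2) else 0 := by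
  obtain ⟨q, i, k⟩ := t
  obtain ⟨⟨x, i', p, k'⟩, hs⟩ := s
  rw [Matrix.mul_apply]
  split_ifs with h
  · obtain ⟨hq, rfl⟩ := h
    have hmem := η.inLayerX_qcell hq i hs.1 k
    rw [Finset.sum_eq_single ⟨(x, i, qcell q, k), hmem⟩]
    · simp [gQX, dXX_apply, qpos_eq_iff, hq]
    · rintro ⟨⟨x', i'', p', k''⟩, hr⟩ - hne
      simp only [gQX, Matrix.of_apply, dXX_apply, qpos_eq_iff]
      by_cases hx : x' = x
      · subst hx
        rw [if_neg, zero_mul]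
        rintro ⟨-, rfl, h2, rfl⟩
        apply hne
        subst h2
        rfl
      · simp [hx]
    · simp
  · refine Finset.sum_eq_zero ?_
    rintro ⟨⟨x', i'', p', k''⟩, hr⟩ -
    simp only [gQX, Matrix.of_apply, dXX_apply]
    by_cases hx : x' = x
    · subst hx
      rw [if_neg, zero_mul]
      rintro ⟨h1, rfl, -, -⟩
      exact h ⟨h1, Fin.ext (hr.1.trans hs.1.symm)⟩
    · simp [hx]

theorem dQQ_mul_gQX (t : η.QCell) (s : η.XCell) :
    (η.dQQ * η.gQX) t s = if t.1 ∈ A.suppX s.1.1 ∧ s.1.2.2.1 = qcell t.1 then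
      tensorD (repD η.LX) (repD η.LZ)ᵀ t.2 (s.1.2.1, s.1.2.2.2) else 0 := by
  obtain ⟨q, i, k⟩ := t
  obtain ⟨⟨x, i', p, k'⟩, hs⟩ := s
  rw [Matrix.mul_apply, Finset.sum_eq_single (q, i', k')]
  · simp only [gQX, Matrix.of_apply, dQQ_apply, if_true, qpos_eq_iff]
    simp
  · rintro ⟨q', i'', k''⟩ - hne
    simp only [gQX, Matrix.of_apply, dQQ_apply]
    by_cases hq : q = q'
    · subst hq
      rw [if_neg (t := (1 : ZMod 2)), mul_zero]
      rintro ⟨-, rfl, -, rfl⟩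
      exact hne rfl
    · simp [hq]
  · simp

theorem gQX_compat : η.gQX * η.dXX + η.dQQ * η.gQX = 0 := by
  ext t s
  rw [Matrix.add_apply, gQX_mul_dXX, dQQ_mul_gQX, Matrix.zero_apply, gridD_apply,
    tensorD_apply (repD η.LX) (repD η.LZ)ᵀ]
  obtain ⟨q, i, k⟩ := t
  obtain ⟨⟨x, i', p, k'⟩, hs⟩ := s
  have hi : i'.val % 2 = 0 := by
    have := hs.1
    simp only at this
    omega
  simp only [planeD_qcell, ite_self, zero_add, repD_even i i' hi, Matrix.transpose_apply]
  by_cases hq : q ∈ A.suppX x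
  · by_cases h1 : i = i'
    · subst h1
      by_cases h2 : p = qcell q
      · simp only [hq, h2, repD_even i i hi, true_and, and_true, if_true, ite_self, zero_add]
        exact CharTwo.add_self_eq_zero _
      · simp [h2, hq]
    · simp [h1]
  · simp [hq]

theorem gZQ_mul_dQQ (t : η.ZCell) (s : η.QCell) :
    (η.gZQ * η.dQQ) t s = if s.1 ∈ A.suppZ t.1.1 ∧ t.1.2.2.1 = qcell s.1 then
      tensorD (repD η.LX) (repD η.LZ)ᵀ (t.1.2.1, t.1.2.2.2) s.2 else 0 := by
  obtain ⟨q, i, k⟩ := s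
  obtain ⟨⟨z, i', p, k'⟩, ht⟩ := t
  rw [Matrix.mul_apply, Finset.sum_eq_single (q, i', k')]
  · simp only [gZQ, Matrix.of_apply, dQQ_apply, if_true, qpos_eq_iff]
    simp
  · rintro ⟨q', i'', k''⟩ - hne
    simp only [gZQ, Matrix.of_apply, dQQ_apply]
    by_cases hq : q' = q
    · subst hq
      rw [if_neg (t := (1 : ZMod 2)), zero_mul]
      rintro ⟨-, rfl, -, rfl⟩
      exact hne rfl
    · simp [hq]
  · simp

theorem dZZ_mul_gZQ (t : η.ZCell) (s : η.QCell) :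
    (η.dZZ * η.gZQ) t s = if s.1 ∈ A.suppZ t.1.1 ∧ s.2.2 = t.1.2.2.2 then
      gridD _ _ _ t.1.2 (s.2.1, qcell s.1, s.2.2) else 0 := by
  obtain ⟨q, i, k⟩ := s
  obtain ⟨⟨z, i', p, k'⟩, ht⟩ := t
  rw [Matrix.mul_apply]
  split_ifs with h
  · obtain ⟨hq, rfl⟩ := h
    have hmem := η.inLayerZ_qcell hq i k ht.1
    rw [Finset.sum_eq_single ⟨(z, i, qcell q, k), hmem⟩]
    · simp [gZQ, dZZ_apply, qpos_eq_iff, hq]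
    · rintro ⟨⟨z', i'', p', k''⟩, hr⟩ - hne
      simp only [gZQ, Matrix.of_apply, dZZ_apply, qpos_eq_iff]
      by_cases hz : z = z'
      · subst hz
        rw [if_neg (t := (1 : ZMod 2)), mul_zero]
        rintro ⟨-, rfl, h2, rfl⟩
        apply hne
        subst h2
        rfl
      · simp [hz]
    · simp
  · refine Finset.sum_eq_zero ?_
    rintro ⟨⟨z', i'', p', k''⟩, hr⟩ -
    simp only [gZQ, Matrix.of_apply, dZZ_apply]
    by_cases hz : z = z'
    · subst hz
      rw [if_neg (t := (1 : ZMod 2)), mul_zero]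
      rintro ⟨h1, -, -, rfl⟩
      exact h ⟨h1, Fin.ext (hr.1.trans ht.1.symm)⟩
    · simp [hz]

theorem gZQ_compat : η.gZQ * η.dQQ + η.dZZ * η.gZQ = 0 := by
  ext t s
  rw [Matrix.add_apply, gZQ_mul_dQQ, dZZ_mul_gZQ, Matrix.zero_apply, gridD_apply,
    tensorD_apply (repD η.LX) (repD η.LZ)ᵀ]
  obtain ⟨q, i, k⟩ := s
  obtain ⟨⟨z, i', p, k'⟩, ht⟩ := t
  have hk : k'.val % 2 = 0 := by
    have := ht.1
    simp only at this
    omega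
  simp only [planeD_qcell, ite_self, zero_add, repD_even k k' hk, Matrix.transpose_apply, add_zero]
  by_cases hq : q ∈ A.suppZ z
  · by_cases h1 : k = k'
    · subst h1
      by_cases h2 : p = qcell q
      · simp only [hq, h2, repD_even k k hk, and_true, if_true, ite_self, add_zero]
        exact CharTwo.add_self_eq_zero _
      · simp [h2, hq]
    · simp [h1, Ne.symm h1]
  · simp [hq]

theorem pZX_mul_dXX (t : η.ZCell) (s : η.XCell) :
    (η.pZX * η.dXX) t s =
      if t.1.2.1.val = 2 * (η.etaX s.1.1).val ∧ s.1.2.2.2.val = 2 * (η.etaZ t.1.1).val then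
        ∑ e, tensorD (repD L) (repD L) s.1.2.2.1 e *
          (defectCount (A.suppX s.1.1 ∩ A.suppZ t.1.1) e t.1.2.2.1 : ZMod 2)
      else 0 := by
  obtain ⟨⟨z, it, pt, kt⟩, ht⟩ := t
  obtain ⟨⟨x, i, p, k⟩, hs⟩ := s
  have hi : i.val = 2 * (η.etaX x).val := hs.1
  simp only
  set c : Prop := it.val = 2 * (η.etaX x).val ∧ k.val = 2 * (η.etaZ z).val with hc
  set G : X × η.Grid → ZMod 2 := fun r =>
    if r.1 = x then if r.2.1 = i then if r.2.2.2 = k then if c then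
      tensorD (repD L) (repD L) p r.2.2.1 *
        (defectCount (A.suppX x ∩ A.suppZ z) r.2.2.1 pt : ZMod 2) else 0 else 0 else 0 else 0
    with hG
  have h1 : (η.pZX * η.dXX) ⟨(z, it, pt, kt), ht⟩ ⟨(x, i, p, k), hs⟩ =
      ∑ r : η.XCell, G r.1 := by
    rw [Matrix.mul_apply]
    refine Finset.sum_congr rfl ?_
    rintro ⟨⟨x', i', p', k'⟩, hr⟩ -
    simp only [pZX, Matrix.of_apply, dXX_apply, hG]
    by_cases hx : x' = x
    · subst hx
      have hii : i' = i := Fin.ext (hr.1.trans hi.symm)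
      subst hii
      rw [if_pos rfl, if_pos rfl, if_pos rfl, gridD_apply]
      simp only [repD_even i' i' (by omega), ite_self, zero_add, true_and]
      by_cases h2 : k' = k
      · subst h2
        by_cases h4 : c
        · have : k'.val % 2 = 0 := by
            have := h4.2
            omega
          rw [if_pos h4, if_pos h4, repD_even k' k' this]
          simp [mul_comm]
        · rw [if_neg h4, if_neg h4]
          simp
      · have h2' : k ≠ k' := fun h => h2 h.symm
        rw [if_neg h2]
        by_cases h3 : k'.val = 2 * (η.etaZ z).val
        · simp [repD_even k k' (by omega), h2']
        · simp [h3]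
    · simp [hx]
  rw [h1, sum_subtype_of_support (fun c : X × η.Grid => η.InLayerX c.1 c.2) G]
  · simp [Fintype.sum_prod_type, hG, hc]
  · rintro ⟨x', i', p', k'⟩ hr
    simp only [hG] at hr
    split_ifs at hr with h2 h3 h4 h5
    · subst h2
      subst h3
      exact ⟨hi, Or.inl ((defectCount_mem (right_ne_zero_of_mul hr)).1.mono
        Finset.inter_subset_left)⟩
    all_goals exact absurd rfl hr

theorem dZZ_mul_pZX (t : η.ZCell) (s : η.XCell) :
    (η.dZZ * η.pZX) t s =
      if t.1.2.1.val = 2 * (η.etaX s.1.1).val ∧ s.1.2.2.2.val = 2 * (η.etaZ t.1.1).val then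
        ∑ e, tensorD (repD L) (repD L) t.1.2.2.1 e *
          (defectCount (A.suppX s.1.1 ∩ A.suppZ t.1.1) s.1.2.2.1 e : ZMod 2)
      else 0 := by
  obtain ⟨⟨z, i, p, k⟩, ht⟩ := t
  obtain ⟨⟨x, i_s, ps, ks⟩, hs⟩ := s
  have hk : k.val = 2 * (η.etaZ z).val := ht.1
  simp only
  set c : Prop := i.val = 2 * (η.etaX x).val ∧ ks.val = 2 * (η.etaZ z).val with hc
  set G : Z × η.Grid → ZMod 2 := fun r =>
    if r.1 = z then if r.2.1 = i then if r.2.2.2 = k then if c then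
      tensorD (repD L) (repD L) p r.2.2.1 *
        (defectCount (A.suppX x ∩ A.suppZ z) ps r.2.2.1 : ZMod 2) else 0 else 0 else 0 else 0
    with hG
  have h1 : (η.dZZ * η.pZX) ⟨(z, i, p, k), ht⟩ ⟨(x, i_s, ps, ks), hs⟩ =
      ∑ r : η.ZCell, G r.1 := by
    rw [Matrix.mul_apply]
    refine Finset.sum_congr rfl ?_
    rintro ⟨⟨z', i', p', k'⟩, hr⟩ -
    simp only [pZX, Matrix.of_apply, dZZ_apply, hG]
    by_cases hz : z' = z
    · subst hz
      have hkk : k' = k := Fin.ext (hr.1.trans hk.symm)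
      subst hkk
      rw [if_pos rfl, if_pos rfl, if_pos rfl, gridD_apply]
      simp only [repD_even k' k' (by omega), ite_self, add_zero, and_true]
      by_cases h2 : i' = i
      · subst h2
        by_cases h4 : c
        · have : i'.val % 2 = 0 := by
            have := h4.1
            omega
          rw [if_pos h4, if_pos h4, repD_even i' i' this]
          simp
        · rw [if_neg h4, if_neg h4]
          simp
      · have h2' : i ≠ i' := fun h => h2 h.symm
        rw [if_neg h2]
        by_cases h3 : i'.val = 2 * (η.etaX x).val
        · simp [repD_even i i' (by omega), h2']
        · simp [h3]
    · simp [hz, Ne.symm hz]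
  rw [h1, sum_subtype_of_support (fun c : Z × η.Grid => η.InLayerZ c.1 c.2) G]
  · simp [Fintype.sum_prod_type, hG, hc]
  · rintro ⟨z', i', p', k'⟩ hr
    simp only [hG] at hr
    split_ifs at hr with h2 h3 h4 h5
    · subst h2
      subst h4
      exact ⟨hk, Or.inl ((defectCount_mem (right_ne_zero_of_mul hr)).2.mono
        Finset.inter_subset_right)⟩
    all_goals exact absurd rfl hr

theorem gZQ_mul_gQX (t : η.ZCell) (s : η.XCell) :
    (η.gZQ * η.gQX) t s =
      if t.1.2.1.val = 2 * (η.etaX s.1.1).val ∧ s.1.2.2.2.val = 2 * (η.etaZ t.1.1).val then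
        ∑ q ∈ A.suppX s.1.1 ∩ A.suppZ t.1.1,
          if qpos q = (s.1.2.2.1.1.val, s.1.2.2.1.2.val) ∧
            qpos q = (t.1.2.2.1.1.val, t.1.2.2.1.2.val) then 1 else 0
      else 0 := by
  obtain ⟨⟨z, i, p, k⟩, ht⟩ := t
  obtain ⟨⟨x, i', p', k'⟩, hs⟩ := s
  have hk : k.val = 2 * (η.etaZ z).val := ht.1
  have hi : i'.val = 2 * (η.etaX x).val := hs.1
  simp only
  have h1 : (η.gZQ * η.gQX) ⟨(z, i, p, k), ht⟩ ⟨(x, i', p', k'), hs⟩ =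
      ∑ q, if i = i' then if k' = k then
        (if q ∈ A.suppX x ∩ A.suppZ z then if qpos q = (p'.1.val, p'.2.val) ∧
            qpos q = (p.1.val, p.2.val) then (1 : ZMod 2) else 0 else 0) else 0 else 0 := by
    rw [Matrix.mul_apply, Fintype.sum_prod_type]
    refine Finset.sum_congr rfl fun q _ => ?_
    rw [Finset.sum_eq_single (i, k)]
    · have key : ∀ (a b : Prop) [Decidable a] [Decidable b],
          (if a then (1 : ZMod 2) else 0) * (if b then 1 else 0) = if a ∧ b then 1 else 0 := by
        intro a b _ _
        by_cases ha : a <;> by_cases hb : b <;> simp [ha, hb]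
      simp only [gZQ, gQX, Matrix.of_apply, ← ite_and, key]
      refine if_congr ?_ rfl rfl
      rw [Finset.mem_inter, eq_comm (a := qpos q), eq_comm (a := qpos q), eq_comm (a := i)]
      tauto
    · rintro ⟨i1, k1⟩ - hne
      simp only [gZQ, gQX, Matrix.of_apply]
      rw [if_neg (t := (1 : ZMod 2)), zero_mul]
      rintro ⟨-, rfl, -, rfl⟩
      exact hne rfl
    · simp
  rw [h1]
  by_cases h2 : i = i'
  · by_cases h3 : k' = k
    · rw [if_pos ⟨by rw [h2, hi], by rw [h3, hk]⟩]
      simp only [h2, h3, if_true, Finset.sum_ite_mem, Finset.univ_inter]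
    · rw [if_neg fun h => h3 (Fin.ext (h.2.trans hk.symm))]
      simp [h3]
  · rw [if_neg fun h => h2 (Fin.ext (h.1.trans hi.symm))]
    simp [h2]

theorem pZX_compat : η.gZQ * η.gQX + (η.pZX * η.dXX + η.dZZ * η.pZX) = 0 := by
  ext t s
  rw [Matrix.add_apply, Matrix.add_apply, gZQ_mul_gQX, pZX_mul_dXX, dZZ_mul_pZX,
    Matrix.zero_apply]
  split_ifs
  · rw [defectCount_compat _ (even_common _ _)]
    exact CharTwo.add_self_eq_zero _
  · simp

theorem totalD_mul_totalD : η.totalD * η.totalD = 0 := by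
  unfold totalD
  rw [Matrix.fromBlocks_multiply, Matrix.fromRows_mul, Matrix.fromBlocks_mul_fromRows,
    Matrix.fromBlocks_multiply, dXX_mul_dXX, dQQ_mul_dQQ, dZZ_mul_dZZ]
  simp only [Matrix.mul_zero, Matrix.zero_mul, add_zero, zero_add, gZQ_compat]
  have h1 : Matrix.fromRows (η.gQX * η.dXX) (η.pZX * η.dXX) +
      Matrix.fromRows (η.dQQ * η.gQX) (η.gZQ * η.gQX + η.dZZ * η.pZX) = 0 := by
    ext t s
    rcases t with t | t
    · exact congrFun (congrFun η.gQX_compat t) s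
    · have := congrFun (congrFun η.pZX_compat t) s
      simp only [Matrix.add_apply, Matrix.fromRows_apply_inr, Matrix.zero_apply] at this ⊢
      linear_combination this
  rw [h1]
  simp

variable {η} in
theorem InLayerX.gridDim_le {x : X} {c : η.Grid} (h : η.InLayerX x c) : gridDim c ≤ 2 := by
  obtain ⟨h1, h2⟩ := h
  have ha := rdim_le c.2.1.1
  have hb := rdim_le c.2.1.2
  have hk := rdim_le c.2.2
  unfold gridDim planeDim
  have h3 : rdim c.1 = 0 := by
    unfold rdim
    omega
  rcases h2 with ⟨q, -, h2 | h2⟩ | h2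
  · have : rdim c.2.1.1 = 0 := by
      simp only [qpos] at h2
      unfold rdim
      omega
    omega
  · have : rdim c.2.1.2 = 0 := by
      simp only [qpos] at h2
      unfold rdim
      omega
    omega
  · have : rdim c.2.2 = 0 := by
      unfold rdim
      omega
    omega

theorem deg_of_totalD_ne_zero {t s : η.Cell} (h : η.totalD t s ≠ 0) :
    η.deg s = η.deg t + 1 := by
  rcases s with s | s | s <;> rcases t with t | t | t
  · replace h : η.dXX t s ≠ 0 := h
    rw [dXX_apply] at h
    have h1 := gridD_ne_zero (ite_ne_right_iff.1 h).2
    have h2 := t.2.gridDim_le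
    simp only [deg]
    omega
  · replace h : η.gQX t s ≠ 0 := h
    obtain ⟨q, i, k⟩ := t
    obtain ⟨⟨x, i', p, k'⟩, hs⟩ := s
    have hs1 : i'.val = 2 * (η.etaX x).val := hs.1
    simp only [gQX, Matrix.of_apply, qpos_eq_iff] at h
    have h1 := (ite_ne_right_iff.1 h).1
    obtain ⟨-, rfl, rfl, rfl⟩ := h1
    simp only [deg, gridDim, planeDim, rdim, qcell]
    omega
  · replace h : η.pZX t s ≠ 0 := h
    obtain ⟨⟨z, i, p, k⟩, ht⟩ := t
    obtain ⟨⟨x, i', p', k'⟩, hs⟩ := s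
    have hs1 : i'.val = 2 * (η.etaX x).val := hs.1
    have ht1 : k.val = 2 * (η.etaZ z).val := ht.1
    simp only [pZX, Matrix.of_apply] at h
    obtain ⟨⟨h1, h2⟩, h3⟩ := ite_ne_right_iff.1 h
    have h4 := defectCount_dim h3
    simp only [deg, gridDim]
    have e1 : rdim i = 0 := by unfold rdim; omega
    have e2 : rdim i' = 0 := by unfold rdim; omega
    have e3 : rdim k = 0 := by unfold rdim; omega
    have e4 : rdim k' = 0 := by unfold rdim; omega
    omega
  · exact absurd rfl h
  · replace h : η.dQQ t s ≠ 0 := h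
    rw [dQQ_apply] at h
    have h1 := (ite_ne_right_iff.1 h).2
    have hk := rdim_le s.2.2
    simp only [deg]
    rcases tensorD_ne_zero h1 with ⟨h2, h3⟩ | ⟨h2, h3⟩
    · have := repD_ne_zero h2
      rw [h3]
      omega
    · have := repD_ne_zero (show repD η.LZ s.2.2 t.2.2 ≠ 0 from h3)
      have := rdim_le t.2.2
      rw [h2]
      omega
  · replace h : η.gZQ t s ≠ 0 := h
    obtain ⟨q, i, k⟩ := s
    obtain ⟨⟨z, i', p, k'⟩, ht⟩ := t
    have ht1 : k'.val = 2 * (η.etaZ z).val := ht.1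
    simp only [gZQ, Matrix.of_apply, qpos_eq_iff] at h
    have h1 := (ite_ne_right_iff.1 h).1
    obtain ⟨-, rfl, rfl, rfl⟩ := h1
    simp only [deg, gridDim, planeDim, rdim, qcell]
    omega
  · exact absurd rfl h
  · exact absurd rfl h
  · replace h : η.dZZ t s ≠ 0 := h
    rw [dZZ_apply] at h
    have h1 := gridD_ne_zero (ite_ne_right_iff.1 h).2
    simp only [deg]
    omega

theorem diff_mul_diff (s : ℕ) : η.diff s * η.diff (s + 1) = 0 := by
  ext a b
  have h := congrFun (congrFun η.totalD_mul_totalD a.1) b.1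
  rw [Matrix.mul_apply, Matrix.zero_apply] at h ⊢
  refine Eq.trans (sum_subtype_of_support (fun c => η.deg c = s + 1)
    (fun c => η.totalD a.1 c * η.totalD c b.1) fun c hc => ?_) h
  have := η.deg_of_totalD_ne_zero (right_ne_zero_of_mul hc)
  have h2 := b.2
  omega

/-! ### The 4D Layer Code as a CSS code -/

/-- The 4D Layer Code of `A` for the choices `η`, with the cells of degree `2`, `1`, `0` as
`X`-checks, qubits and `Z`-checks. -/
def code : CSSComplex (η.CellOf 2) (η.CellOf 1) (η.CellOf 0) where
  d₂ := η.diff 1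
  d₁ := η.diff 0
  d₁_mul_d₂ := η.diff_mul_diff 0

end Coloring

end Compatibility

end LayerCode

/-!
The distances of a 4D Layer Code `C` of `A` obey `d_X(C) ≥ (L_Z / w_X) d_X(A)` and
`d_Z(C) ≥ (L_X / w_Z) d_Z(A)`, with `L_X, L_Z ≥ L`. These bounds imply all the stated ones, with
constant one.

A cycle `l` of `C` has components on the `X`-check, the qubit and the `Z`-check layers. The layers
`C(x)` have no first cohomology (`Coloring.exists_dXX_eq`), so the component on `C(x)` is the
coboundary of a set `s` of vertices. Adding the boundary of `s` to `l` leaves a cycle of the other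
layers. The first homology of the qubit layer `C(q) = R_X ⊗ q ⊗ R_Zᵀ` is spanned by the line over a
vertex of `R_X`, so that at each height `k` of `R_Z` the cycle has the same coefficient `a q`. The
sum of the coefficients over the vertices of `C(z)` shows that `a` is a cycle of `A`, and if `a`
is a boundary then so is `l`, because `C(z)` has no first homology
(`Coloring.cycle_of_slices`).

At a height `k`, choose a qubit of each `x` and add to `a` the boundary of the set of those `x` for
which that qubit lies in `s` at height `k`. The result `b` is homologous to `a`, hence nontrivial if
`l` is, and has weight at least `d_X(A)`. If `b q ≠ 0`, then either `l` has a cell of `C(q)` at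
height `k`, or some `x ∼ q` has another qubit on the other side of `s`; as `AB(x)` joins the two
qubits within the height, `l` has an edge of `C(x)` at height `k`. Each of these cells accounts for
at most `w_X` qubits, so `l` has at least `d_X(A) / w_X` cells at each of the `L_Z` heights
(`Coloring.dX_le_supportAt`).

Of the defect map only its degree and the vanishing of the square of the differential matter. The
cocomplex of `C` is
therefore of the same kind as the Layer Code of the cocomplex of `A`, up to the defect map
(`Coloring.totalD_transpose`), which gives the bound on `d_Z` and turns the vanishing of the first
cohomology of `C(x)` into the vanishing of the first homology of `C(z)`.

For the existence of colourings, let two checks conflict if they have qubits in a common row or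
column. Greedy colouring needs at most `2 w q L + 1` colours, and checks of the same colour have no
common row, so that the row of a qubit is a plane colour (`exists_line_plane_coloring`).
-/

namespace LayerCode

/-! ### Existence of colourings -/

/-- Greedy colouring: `χ` colours suffice if every point conflicts with fewer than `χ` others. -/
theorem exists_greedy_coloring {X : Type*} [Fintype X] (R : X → X → Prop)
    (hR : ∀ x y, R x y → R y x) (χ : ℕ) (T : X → Finset X) (hT : ∀ x y, x ≠ y → R x y → y ∈ T x)
    (hcard : ∀ x, (T x).card < χ) :
    ∃ η : X → Fin χ, ∀ x y, x ≠ y → R x y → η x ≠ η y := by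
  classical
  suffices h : ∀ s : Finset X, ∃ η : X → Fin χ, ∀ x ∈ s, ∀ y ∈ s, x ≠ y → R x y → η x ≠ η y by
    obtain ⟨η, hη⟩ := h Finset.univ
    exact ⟨η, fun x y => hη x (Finset.mem_univ _) y (Finset.mem_univ _)⟩
  intro s
  induction s using Finset.induction_on with
  | empty => exact ⟨fun x => ⟨0, (Nat.zero_le _).trans_lt (hcard x)⟩, by simp⟩
  | insert a s ha ih =>
    obtain ⟨η, hη⟩ := ih
    obtain ⟨c, hc⟩ : ∃ c, c ∉ (T a).image η := by
      by_contra! h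
      have h1 : (T a).image η = Finset.univ := Finset.eq_univ_iff_forall.2 h
      have h2 := Finset.card_image_le (s := T a) (f := η)
      rw [h1, Finset.card_univ, Fintype.card_fin] at h2
      exact absurd (hcard a) (by omega)
    have hne : ∀ y ∈ s, R a y → c ≠ η y := by
      rintro y hy h rfl
      exact hc (Finset.mem_image_of_mem _ (hT a y (fun h => ha (h ▸ hy)) h))
    have hs : ∀ y ∈ s, y ≠ a := by
      rintro y hy rfl
      exact ha hy
    refine ⟨Function.update η a c, fun x hx y hy hxy h => ?_⟩
    rcases Finset.mem_insert.1 hx with h1 | hx' <;> rcases Finset.mem_insert.1 hy with h2 | hy'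
    · exact absurd (h1.trans h2.symm) hxy
    · subst h1
      rw [Function.update_self, Function.update_of_ne (hs y hy')]
      exact hne y hy' h
    · subst h2
      rw [Function.update_self, Function.update_of_ne (hs x hx')]
      exact (hne x hx' (hR _ _ h)).symm
    · rw [Function.update_of_ne (hs x hx'), Function.update_of_ne (hs y hy')]
      exact hη x hx' y hy' hxy h

/-- If every check acts on at least one qubit, `w` bounds the weights of the checks and `d` the
numbers of checks acting on a qubit, then `χ ≥ 3 w d L` line colours admit a line colouring and a
plane colouring. Checks get different line colours as soon as they share a row or a column of
`[L]²`, so that a row met by a check is a plane colour. -/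
theorem exists_line_plane_coloring {L : ℕ} {X : Type*} [Fintype X] (S : X → Finset (Fin L × Fin L))
    (hS : ∀ x, (S x).Nonempty) (w d χ : ℕ) (hw : ∀ x, (S x).card ≤ w)
    (hd : ∀ q, ∃ D : Finset X, D.card ≤ d ∧ ∀ x, q ∈ S x → x ∈ D) (hχ : 3 * w * d * L ≤ χ) :
    ∃ (η : X → Fin χ) (ω : X → Fin L), IsLineColoring S η ∧ IsPlaneColoring η ω := by
  classical
  choose D hDcard hD using hd
  choose q hq using hS
  let R : X → X → Prop := fun x y => ∃ u ∈ S x, ∃ v ∈ S y, u.1 = v.1 ∨ u.2 = v.2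
  let T : X → Finset X := fun x => (S x).biUnion fun u =>
    (Finset.univ.biUnion fun b => D (u.1, b)) ∪ (Finset.univ.biUnion fun a => D (a, u.2))
  have hcard : ∀ x, (T x).card < χ := by
    intro x
    have h1 : (T x).card ≤ (S x).card * (L * d + L * d) := by
      refine Finset.card_biUnion_le_card_mul _ _ _ fun u _ => (Finset.card_union_le _ _).trans ?_
      have hL : L = (Finset.univ : Finset (Fin L)).card := by simp
      refine Nat.add_le_add ?_ ?_
      · refine (Finset.card_biUnion_le_card_mul _ _ d fun b _ => hDcard _).trans_eq ?_
        rw [← hL]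
      · refine (Finset.card_biUnion_le_card_mul _ _ d fun b _ => hDcard _).trans_eq ?_
        rw [← hL]
    have h2 : (S x).card * (L * d + L * d) ≤ w * (L * d + L * d) := Nat.mul_le_mul_right _ (hw x)
    have hw0 : 0 < w := (Finset.card_pos.2 ⟨_, hq x⟩).trans_le (hw x)
    have hd0 : 0 < d := (Finset.card_pos.2 ⟨x, hD _ x (hq x)⟩).trans_le (hDcard _)
    have hL0 : 0 < L := (Nat.zero_le _).trans_lt (q x).1.2
    have h3 : 0 < w * d * L := by positivity
    have h4 : w * (L * d + L * d) = 2 * (w * d * L) := by ring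
    have h5 : 3 * w * d * L = 3 * (w * d * L) := by ring
    omega
  obtain ⟨η, hη⟩ := exists_greedy_coloring R
    (by
      rintro x y ⟨u, hu, v, hv, h⟩
      exact ⟨v, hv, u, hu, h.imp Eq.symm Eq.symm⟩) χ T
    (by
      rintro x y - ⟨u, hu, v, hv, h⟩
      refine Finset.mem_biUnion.2 ⟨u, hu, Finset.mem_union.2 (h.imp ?_ ?_)⟩ <;> intro h
      · exact Finset.mem_biUnion.2 ⟨v.2, Finset.mem_univ _, hD _ _ (by rw [h]; exact hv)⟩
      · exact Finset.mem_biUnion.2 ⟨v.1, Finset.mem_univ _, hD _ _ (by rw [h]; exact hv)⟩) hcard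
  refine ⟨η, fun x => (q x).1, ?_, ?_⟩
  · rintro x y hxy h e he ⟨⟨u, hu, h1⟩, ⟨v, hv, h2⟩⟩
    refine hη x y hxy ⟨u, hu, v, hv, ?_⟩ h
    -- an edge has one odd coordinate, hence lies on a single line of the grid
    simp only [planeDim, rdim, qpos, Fin.ext_iff] at *
    omega
  · intro x y h1 h2
    by_contra hxy
    exact hη x y hxy ⟨q x, hq x, q y, hq y, Or.inl h2⟩ h1

theorem exists_coloring {L : ℕ} {X Z : Type*} [Fintype X] [Fintype Z]
    (A : CSSComplex X (Fin L × Fin L) Z) (hX : ∀ x, (A.suppX x).Nonempty)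
    (hZ : ∀ z, (A.suppZ z).Nonempty) (χX χZ : ℕ) (hχX : 3 * A.wX * A.qX * L ≤ χX)
    (hχZ : 3 * A.wZ * A.qZ * L ≤ χZ) : Nonempty (Coloring A χX χZ) := by
  obtain ⟨ηX, ωX, h1, h2⟩ := exists_line_plane_coloring A.suppX hX A.wX A.qX χX
    (fun x => Finset.le_sup (f := fun x => (A.suppX x).card) (Finset.mem_univ x))
    (fun q => ⟨_, Finset.le_sup (f := A.degX) (Finset.mem_univ q), by simp [CSSComplex.suppX]⟩) hχX
  obtain ⟨ηZ, ωZ, h3, h4⟩ := exists_line_plane_coloring A.suppZ hZ A.wZ A.qZ χZ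
    (fun x => Finset.le_sup (f := fun x => (A.suppZ x).card) (Finset.mem_univ x))
    (fun q => ⟨_, Finset.le_sup (f := A.degZ) (Finset.mem_univ q), by simp [CSSComplex.suppZ]⟩) hχZ
  exact ⟨⟨ηX, ηZ, ωX, ωZ, h1, h3, h2, h4⟩⟩

/-! ### Graded matrices and duality -/

section LinearAlgebra

variable {α : Type*}

/-- Extension by zero of a chain on the cells satisfying `p`. -/
def extendZero (p : α → Prop) [DecidablePred p] (l : {c // p c} → ZMod 2) : α → ZMod 2 :=
  fun c => if h : p c then l ⟨c, h⟩ else 0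

theorem extendZero_val {p : α → Prop} [DecidablePred p] (l : {c // p c} → ZMod 2) (c : {c // p c}) :
    extendZero p l c.1 = l c := by
  simp [extendZero, c.2]

theorem extendZero_of_not {p : α → Prop} [DecidablePred p] (l : {c // p c} → ZMod 2) {c : α}
    (h : ¬ p c) : extendZero p l c = 0 := by
  simp [extendZero, h]

theorem of_extendZero_ne_zero {p : α → Prop} [DecidablePred p] {l : {c // p c} → ZMod 2} {c : α}
    (h : extendZero p l c ≠ 0) : p c := by
  by_contra hc
  exact h (extendZero_of_not l hc)

/-- The restriction of a chain to the cells satisfying `p`. -/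
def truncate (p : α → Prop) [DecidablePred p] (f : α → ZMod 2) : α → ZMod 2 :=
  fun c => if p c then f c else 0

theorem of_truncate_ne_zero {p : α → Prop} [DecidablePred p] {f : α → ZMod 2} {c : α}
    (h : truncate p f c ≠ 0) : p c := by
  by_contra hc
  exact h (if_neg hc)

variable [Fintype α]

theorem sum_subtype_eq_sum_extendZero (p : α → Prop) [DecidablePred p] (g : α → ZMod 2)
    (l : {c // p c} → ZMod 2) : ∑ c, g c.1 * l c = ∑ c, g c * extendZero p l c := by
  rw [← sum_subtype_of_support p (fun c => g c * extendZero p l c)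
    fun c hc => of_extendZero_ne_zero (right_ne_zero_of_mul hc)]
  simp only [extendZero_val]

/-- If `D` maps `p`-cells to `q`-cells and only `p`-cells to `q`-cells, it commutes with the
restriction of chains. -/
theorem mulVec_truncate (D : Matrix α α (ZMod 2)) (p q : α → Prop) [DecidablePred p]
    [DecidablePred q] (h : ∀ t s, D t s ≠ 0 → (p s ↔ q t)) (f : α → ZMod 2) :
    D *ᵥ truncate p f = truncate q (D *ᵥ f) := by
  ext t
  simp only [truncate, Matrix.mulVec, dotProduct]
  by_cases ht : q t
  · rw [if_pos ht]
    refine Finset.sum_congr rfl fun s _ => ?_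
    by_cases h0 : D t s = 0
    · simp [h0]
    · rw [if_pos ((h t s h0).2 ht)]
  · rw [if_neg ht]
    refine Finset.sum_eq_zero fun s _ => ?_
    by_cases h0 : D t s = 0
    · simp [h0]
    · rw [if_neg (fun hp => ht ((h t s h0).1 hp)), mul_zero]

theorem mulVec_extendZero_eq_zero (D : Matrix α α (ZMod 2)) (p q : α → Prop) [DecidablePred p]
    (h : ∀ t s, D t s ≠ 0 → p s → q t) (l : {c // p c} → ZMod 2)
    (hl : (D.submatrix Subtype.val Subtype.val : Matrix {c // q c} {c // p c} (ZMod 2)) *ᵥ l = 0) :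
    D *ᵥ extendZero p l = 0 := by
  ext t
  by_cases ht : q t
  · refine Eq.trans ?_ (congrFun hl ⟨t, ht⟩)
    exact (sum_subtype_eq_sum_extendZero p (D t) l).symm
  · refine Finset.sum_eq_zero fun s _ => ?_
    by_contra h0
    exact ht (h t s (left_ne_zero_of_mul h0) (of_extendZero_ne_zero (right_ne_zero_of_mul h0)))

theorem submatrix_mulVec_eq (D : Matrix α α (ZMod 2)) (p q : α → Prop) [DecidablePred p]
    [DecidablePred q] (h : ∀ t s, D t s ≠ 0 → p t → q s) (l : {c // p c} → ZMod 2) (S : α → ZMod 2)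
    (hS : D *ᵥ S = extendZero p l) :
    (D.submatrix Subtype.val Subtype.val : Matrix {c // p c} {c // q c} (ZMod 2)) *ᵥ
      (fun c => S c.1) = l := by
  ext t
  rw [← extendZero_val l t, ← hS]
  exact sum_subtype_of_support q (fun s => D t.1 s * S s) fun s hs =>
    h _ _ (left_ne_zero_of_mul hs) t.2

theorem hammingNorm_extendZero (p : α → Prop) [DecidablePred p] (l : {c // p c} → ZMod 2) :
    hammingNorm (extendZero p l) = hammingNorm l := by
  classical
  unfold hammingNorm
  symm
  refine Finset.card_bij (fun c _ => c.1) ?_ (fun a _ b _ h => Subtype.ext h) ?_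
  · intro c hc
    simpa [extendZero_val] using hc
  · intro c hc
    have hc' := (Finset.mem_filter.1 hc).2
    refine ⟨⟨c, of_extendZero_ne_zero hc'⟩, ?_, rfl⟩
    rw [Finset.mem_filter, ← extendZero_val l]
    exact ⟨Finset.mem_univ _, hc'⟩

/-- A vector orthogonal to the kernel of `N` lies in the range of the transpose of `N`. -/
theorem exists_transpose_mulVec_eq {β : Type*} [Fintype β] (N : Matrix β α (ZMod 2))
    (l : α → ZMod 2) (h : ∀ v, N *ᵥ v = 0 → v ⬝ᵥ l = 0) : ∃ s, Nᵀ *ᵥ s = l := by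
  classical
  by_contra hc
  obtain ⟨f, hf, hker⟩ := Submodule.exists_le_ker_of_notMem
    (p := LinearMap.range Nᵀ.mulVecLin) (v := l) (by
      rintro ⟨s, hs⟩
      exact hc ⟨s, hs⟩)
  have hfv : ∀ w, f w = (fun i => f (fun j => if i = j then 1 else 0)) ⬝ᵥ w := by
    intro w
    rw [LinearMap.pi_apply_eq_sum_univ]
    simp [dotProduct, mul_comm]
  refine hf ?_
  rw [hfv]
  refine h _ ?_
  ext t
  have h1 : f (Nᵀ *ᵥ Pi.single t 1) = 0 := hker ⟨Pi.single t 1, rfl⟩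
  rw [hfv] at h1
  simpa [Matrix.mulVec, dotProduct, Pi.single_apply, mul_comm] using h1

/-- Exactness of a graded complex at the cells satisfying `p` implies exactness of the dual
complex there. -/
theorem exact_transpose (D : Matrix α α (ZMod 2)) (p q : α → Prop) [DecidablePred p]
    [DecidablePred q] (hD : ∀ t s, D t s ≠ 0 → (p s ↔ q t))
    (hex : ∀ l, (∀ c, l c ≠ 0 → p c) → D *ᵥ l = 0 → ∃ s, D *ᵥ s = l)
    (l : α → ZMod 2) (hl : ∀ c, l c ≠ 0 → p c) (hl0 : Dᵀ *ᵥ l = 0) : ∃ s, Dᵀ *ᵥ s = l := by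
  refine exists_transpose_mulVec_eq D l fun v hv => ?_
  obtain ⟨s, hs⟩ := hex (truncate p v) (fun c => of_truncate_ne_zero) (by
    rw [mulVec_truncate D p q hD, hv]
    ext c
    simp [truncate])
  have h1 : v ⬝ᵥ l = truncate p v ⬝ᵥ l := by
    refine Finset.sum_congr rfl fun c _ => ?_
    by_cases hc : p c
    · simp [truncate, hc]
    · have : l c = 0 := by
        by_contra h0
        exact hc (hl c h0)
      simp [this]
  rw [h1, ← hs, dotProduct_comm, Matrix.dotProduct_mulVec, ← Matrix.mulVec_transpose, hl0,
    zero_dotProduct]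

end LinearAlgebra

/-! ### Contractibility of the check layers -/

/-- The coboundary of the repetition code, for functions of the doubled coordinate. -/
def coboundary (g : ℕ → ZMod 2) (t : ℕ) : ZMod 2 := if t % 2 = 1 then g (t - 1) + g (t + 1) else 0

theorem sum_repD_left {n : ℕ} (t : RCell n) (g : ℕ → ZMod 2) :
    ∑ s, repD n s t * g s.val = coboundary g t.val := by
  unfold coboundary
  split_ifs with h
  · have ht := t.2
    have h1 : ∀ s : RCell n, repD n s t * g s.val =
        (if s = ⟨t.val - 1, by omega⟩ then g s.val else 0) +
        (if s = ⟨t.val + 1, by omega⟩ then g s.val else 0) := by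
      intro s
      rw [repD_edge s t (t.val - 1) (t.val + 1) (by unfold IsEdgeBetween; omega)]
      simp only [Fin.ext_iff, add_mul, ite_mul, one_mul, zero_mul]
    simp only [h1, Finset.sum_add_distrib, Finset.sum_ite_eq', Finset.mem_univ, if_true]
  · refine Finset.sum_eq_zero fun s _ => ?_
    rw [repD_even s t (by omega), zero_mul]

theorem sum_tensorD_left {α β : Type*} [DecidableEq α] [DecidableEq β] [Fintype α] [Fintype β]
    (M : Matrix α α (ZMod 2)) (N : Matrix β β (ZMod 2)) (t : α × β) (G : α × β → ZMod 2) :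
    ∑ s, tensorD M N s t * G s = ∑ a, M a t.1 * G (a, t.2) + ∑ b, N b t.2 * G (t.1, b) := by
  simp only [tensorD_apply, add_mul, Finset.sum_add_distrib, ite_mul, zero_mul]
  congr 1
  · rw [Fintype.sum_prod_type]
    simp
  · rw [Fintype.sum_prod_type_right]
    simp

theorem sum_tensorD_right {α β : Type*} [DecidableEq α] [DecidableEq β] [Fintype α] [Fintype β]
    (M : Matrix α α (ZMod 2)) (N : Matrix β β (ZMod 2)) (t : α × β) (G : α × β → ZMod 2) :
    ∑ s, tensorD M N t s * G s = ∑ a, M t.1 a * G (a, t.2) + ∑ b, N t.2 b * G (t.1, b) := by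
  simp only [tensorD_apply, add_mul, Finset.sum_add_distrib, ite_mul, zero_mul]
  congr 1
  · rw [Fintype.sum_prod_type]
    simp
  · rw [Fintype.sum_prod_type_right]
    simp

/-- Telescoping along a strip of faces with long sides `G`, `H` and rungs `E`. -/
theorem sum_strip (G H E : ℕ → ZMod 2) (hG : ∀ j, j % 2 = 0 → G j = 0)
    (hH : ∀ j, j % 2 = 0 → H j = 0) (k : ℕ) (hk : k % 2 = 0)
    (h : ∀ j, j % 2 = 1 → j < k → G j + H j + (E (j - 1) + E (j + 1)) = 0) :
    ∑ j ∈ Finset.range k, G j + ∑ j ∈ Finset.range k, H j = E k + E 0 := by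
  obtain ⟨t, rfl⟩ : ∃ t, k = 2 * t := ⟨k / 2, by omega⟩
  induction t with
  | zero => simp [CharTwo.add_self_eq_zero]
  | succ t ih =>
    have ih' := ih (by omega) fun j hj hj' => h j hj (by omega)
    have h1 := h (2 * t + 1) (by omega) (by omega)
    rw [show 2 * (t + 1) = 2 * t + 1 + 1 by ring]
    simp only [Finset.sum_range_succ, hG (2 * t) (by omega), hH (2 * t) (by omega)]
    simp only [Nat.add_sub_cancel] at h1
    linear_combination ih' + h1 - CharTwo.add_self_eq_zero (E (2 * t + 1 + 1))

theorem sum_range_edge (G : ℕ → ZMod 2) (hG : ∀ j, j % 2 = 0 → G j = 0) (k : ℕ) (hk : k % 2 = 1) :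
    ∑ j ∈ Finset.range (k - 1), G j + ∑ j ∈ Finset.range (k + 1), G j = G k := by
  obtain ⟨t, rfl⟩ : ∃ t, k = t + 1 := ⟨k - 1, by omega⟩
  simp only [Nat.add_sub_cancel, Finset.sum_range_succ, hG t (by omega)]
  linear_combination CharTwo.add_self_eq_zero (∑ j ∈ Finset.range t, G j)

section Layers

variable {L : ℕ} {X Z : Type*} [Fintype X] [Fintype Z]
  {A : CSSComplex X (Fin L × Fin L) Z} {χX χZ : ℕ}

namespace Coloring

variable (η : Coloring A χX χZ)

/-- The first coordinate of the layer `C(x)`. -/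
def posX (x : X) : RCell η.LX :=
  ⟨2 * (η.etaX x).val, by
    have h1 := (η.etaX x).2
    have h2 : χX ≤ η.LX := le_max_left _ _
    omega⟩

/-- Membership of the cell with doubled coordinates `(a, b, k)` in the layer `C(x)`. -/
def LayerX (x : X) (a b k : ℕ) : Prop :=
  a < 2 * L - 1 ∧ b < 2 * L - 1 ∧ k < 2 * η.LZ - 1 ∧
    ((∃ q ∈ A.suppX x, a = (qpos q).1 ∨ b = (qpos q).2) ∨ k = 2 * (η.omegaX x).val)

variable {η} in
/-- The cell of `C(x)` with doubled coordinates `(a, b, k)`. -/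
def LayerX.cell {x : X} {a b k : ℕ} (h : η.LayerX x a b k) : η.XCell :=
  ⟨(x, η.posX x, (⟨a, h.1⟩, ⟨b, h.2.1⟩), ⟨k, h.2.2.1⟩), rfl, h.2.2.2⟩

theorem layerX_coords (c : η.XCell) :
    η.LayerX c.1.1 c.1.2.2.1.1 c.1.2.2.1.2 c.1.2.2.2 :=
  ⟨c.1.2.2.1.1.2, c.1.2.2.1.2.2, c.1.2.2.2.2, c.2.2⟩

theorem cell_layerX_coords (c : η.XCell) : (η.layerX_coords c).cell = c := by
  obtain ⟨⟨x, i, p, k⟩, h⟩ := c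
  have : i = η.posX x := Fin.ext h.1
  subst this
  rfl

open Classical in
/-- A chain of the `X`-check layers as a function of the doubled coordinates, extended by zero. -/
noncomputable def coordX (f : η.XCell → ZMod 2) (x : X) (a b k : ℕ) : ZMod 2 :=
  if h : η.LayerX x a b k then f h.cell else 0

theorem coordX_cell (f : η.XCell → ZMod 2) {x : X} {a b k : ℕ} (h : η.LayerX x a b k) :
    η.coordX f x a b k = f h.cell := dif_pos h

theorem coordX_coords (f : η.XCell → ZMod 2) (c : η.XCell) :
    η.coordX f c.1.1 c.1.2.2.1.1 c.1.2.2.1.2 c.1.2.2.2 = f c := by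
  rw [coordX_cell _ _ (η.layerX_coords c), cell_layerX_coords]

theorem gridDim_cell {x : X} {a b k : ℕ} (h : η.LayerX x a b k) :
    gridDim h.cell.1.2 = a % 2 + b % 2 + k % 2 := by
  simp only [LayerX.cell, gridDim, planeDim, rdim, posX]
  omega

variable [DecidableEq X] [DecidableEq Z]

/-- The differential of the `X`-check layers is the coboundary of the grid. -/
theorem dXX_mulVec (f : η.XCell → ZMod 2) (V : X → ℕ → ℕ → ℕ → ZMod 2)
    (hf : ∀ c, f c = V c.1.1 c.1.2.2.1.1 c.1.2.2.1.2 c.1.2.2.2) {x : X} {a b k : ℕ}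
    (h : η.LayerX x a b k) :
    (η.dXX *ᵥ f) h.cell = coboundary (fun j => V x j b k) a + coboundary (fun j => V x a j k) b +
      coboundary (fun j => V x a b j) k := by
  set G : X × η.Grid → ZMod 2 := fun c =>
    if c.1 = x then gridD _ _ _ c.2 h.cell.1.2 * V c.1 c.2.2.1.1 c.2.2.1.2 c.2.2.2 else 0
  have h1 : (η.dXX *ᵥ f) h.cell = ∑ c : η.XCell, G c.1 := by
    refine Finset.sum_congr rfl fun c _ => ?_
    simp only [dXX_apply, hf, G, ite_mul, zero_mul]
    exact if_congr eq_comm rfl rfl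
  have h2 : ∑ c : η.XCell, G c.1 = ∑ c, G c := by
    refine sum_subtype_of_support (fun c : X × η.Grid => η.InLayerX c.1 c.2) G fun c hc => ?_
    obtain ⟨hc1, hc2⟩ := ite_ne_right_iff.1 hc
    rw [hc1]
    exact InLayerX.facet (left_ne_zero_of_mul hc2) h.cell.2
  have h3 : ∑ c, G c = ∑ c, gridD _ _ _ c h.cell.1.2 * V x c.2.1.1 c.2.1.2 c.2.2 := by
    rw [Fintype.sum_prod_type, Finset.sum_eq_single x]
    · simp [G]
    · intro y _ hy
      simp [G, hy]
    · simp
  rw [h1, h2, h3]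
  unfold gridD
  rw [sum_tensorD_left, sum_tensorD_left _ _ _ fun c : PlaneCell L × RCell η.LZ => V x c.1.1 c.1.2 c.2,
    sum_tensorD_left _ _ _ fun c : RCell L × RCell L => V x c.1 c.2 h.cell.1.2.2.2]
  rw [sum_repD_left _ fun j => V x j h.cell.1.2.2.1.2 h.cell.1.2.2.2,
    sum_repD_left _ fun j => V x h.cell.1.2.2.1.1 j h.cell.1.2.2.2,
    sum_repD_left _ fun j => V x h.cell.1.2.2.1.1 h.cell.1.2.2.1.2 j]
  have h4 : ∑ i, repD η.LX i h.cell.1.2.1 * V x h.cell.1.2.2.1.1 h.cell.1.2.2.1.2 h.cell.1.2.2.2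
      = 0 := by
    refine Finset.sum_eq_zero fun i _ => ?_
    rw [repD_even i h.cell.1.2.1 (by simp [LayerX.cell, posX]), zero_mul]
  rw [h4, zero_add]
  rfl

theorem dXX_grading (t s : η.XCell) (h : η.dXX t s ≠ 0) :
    gridDim t.1.2 = gridDim s.1.2 + 1 := by
  rw [dXX_apply] at h
  exact gridD_ne_zero (ite_ne_right_iff.1 h).2

/-- The first cohomology of the `X`-check layers vanishes: `C(x)` contracts, first along the last
direction onto the plane `[L]² × ω(x)`, then inside this plane. -/
theorem exists_dXX_eq (l : η.XCell → ZMod 2) (hl : ∀ c, l c ≠ 0 → gridDim c.1.2 = 1)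
    (hl0 : η.dXX *ᵥ l = 0) :
    ∃ s, (∀ c, s c ≠ 0 → gridDim c.1.2 = 0) ∧ η.dXX *ᵥ s = l := by
  set F := η.coordX l with hF
  have hF0 : ∀ x a b k, a % 2 + b % 2 + k % 2 ≠ 1 → F x a b k = 0 := by
    intro x a b k h
    by_contra hc
    by_cases hlay : η.LayerX x a b k
    · rw [hF, coordX_cell _ _ hlay] at hc
      exact h ((η.gridDim_cell hlay).symm.trans (hl _ hc))
    · exact hc (dif_neg hlay)
  have hclosed : ∀ x a b k, η.LayerX x a b k →
      coboundary (fun j => F x j b k) a + coboundary (fun j => F x a j k) b +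
      coboundary (fun j => F x a b j) k = 0 := by
    intro x a b k h
    rw [← η.dXX_mulVec l F (fun c => (η.coordX_coords l c).symm) h, hl0]
    rfl
  let w : X → ℕ := fun x => 2 * (η.omegaX x).val
  -- the sum of `l` over a path from `(0, 0, ω)` through `(0, b, ω)` and `(a, b, ω)` to `(a, b, k)`
  let V : X → ℕ → ℕ → ℕ → ZMod 2 := fun x a b k =>
    ∑ j ∈ Finset.range k, F x a b j + ∑ j ∈ Finset.range (w x), F x a b j +
      ∑ j ∈ Finset.range a, F x j b (w x) + ∑ j ∈ Finset.range b, F x 0 j (w x)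
  have hw : ∀ x, w x < 2 * η.LZ - 1 := by
    intro x
    have h1 := (η.omegaX x).2
    have h2 : L ≤ η.LZ := le_max_right _ _
    simp only [w]
    omega
  have hw2 : ∀ x, w x % 2 = 0 := by
    intro x
    simp only [w]
    omega
  refine ⟨truncate (fun c : η.XCell => gridDim c.1.2 = 0)
    (fun c => V c.1.1 c.1.2.2.1.1 c.1.2.2.1.2 c.1.2.2.2), fun c => of_truncate_ne_zero, ?_⟩
  rw [mulVec_truncate η.dXX (fun c => gridDim c.1.2 = 0) (fun c => gridDim c.1.2 = 1) (by
    intro t s h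
    have := η.dXX_grading t s h
    omega)]
  ext c
  unfold truncate
  split_ifs with hc
  swap
  · by_contra h0
    exact hc (hl c (Ne.symm h0))
  rw [← η.coordX_coords l c, ← hF]
  have hlay := η.layerX_coords c
  have key := η.dXX_mulVec _ V (fun _ => rfl) hlay
  rw [η.cell_layerX_coords] at key
  rw [key]
  have hdim : c.1.2.2.1.1.val % 2 + c.1.2.2.1.2.val % 2 + c.1.2.2.2.val % 2 = 1 := by
    rw [← η.gridDim_cell hlay, η.cell_layerX_coords, hc]
  clear key hc
  generalize c.1.1 = x at *
  generalize c.1.2.2.1.1.val = a at *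
  generalize c.1.2.2.1.2.val = b at *
  generalize c.1.2.2.2.val = k at *
  clear c hl hl0
  obtain ⟨ha, hb, hk, hAB⟩ := hlay
  have hcases : (a % 2 = 1 ∧ b % 2 = 0 ∧ k % 2 = 0) ∨ (a % 2 = 0 ∧ b % 2 = 1 ∧ k % 2 = 0) ∨
      (a % 2 = 0 ∧ b % 2 = 0 ∧ k % 2 = 1) := by omega
  rcases hcases with ⟨h1, h2, h3⟩ | ⟨h1, h2, h3⟩ | ⟨h1, h2, h3⟩
  · -- an edge in the first direction
    have e1 := sum_range_edge (fun j => F x j b (w x))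
      (fun j hj => hF0 _ _ _ _ (by have := hw2 x; omega)) a h1
    have e2 : ∑ j ∈ Finset.range k, F x (a - 1) b j + ∑ j ∈ Finset.range k, F x (a + 1) b j +
        (∑ j ∈ Finset.range (w x), F x (a - 1) b j + ∑ j ∈ Finset.range (w x), F x (a + 1) b j) =
        F x a b k + F x a b (w x) := by
      rcases hAB with hAB | hAB
      · have strip : ∀ k', k' % 2 = 0 → k' < 2 * η.LZ - 1 → _ := fun k' hk' hk'' =>
          sum_strip (fun j => F x (a - 1) b j) (fun j => F x (a + 1) b j) (fun j => F x a b j)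
          (fun j hj => hF0 _ _ _ _ (by omega)) (fun j hj => hF0 _ _ _ _ (by omega)) k' hk'
          (fun j hj hj' => by
            have := hclosed x a b j ⟨ha, hb, by omega, Or.inl hAB⟩
            simpa [coboundary, h1, h2, hj] using this)
        have s1 := strip k h3 hk
        have s2 := strip (w x) (hw2 x) (hw x)
        linear_combination s1 + s2 + CharTwo.add_self_eq_zero (F x a b 0)
      · rw [show k = w x from hAB]
        simp only [CharTwo.add_self_eq_zero]
    simp only [coboundary, h1, h2, h3, if_true, V]
    simp only [zero_ne_one, if_false, add_zero]
    linear_combination e1 + e2 + CharTwo.add_self_eq_zero (F x a b (w x)) +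
      CharTwo.add_self_eq_zero (∑ j ∈ Finset.range b, F x 0 j (w x))
  · -- an edge in the second direction
    have e1 := sum_range_edge (fun j => F x 0 j (w x))
      (fun j hj => hF0 _ _ _ _ (by have := hw2 x; omega)) b h2
    have e2 : ∑ j ∈ Finset.range k, F x a (b - 1) j + ∑ j ∈ Finset.range k, F x a (b + 1) j +
        (∑ j ∈ Finset.range (w x), F x a (b - 1) j + ∑ j ∈ Finset.range (w x), F x a (b + 1) j) =
        F x a b k + F x a b (w x) := by
      rcases hAB with hAB | hAB
      · have strip : ∀ k', k' % 2 = 0 → k' < 2 * η.LZ - 1 → _ := fun k' hk' hk'' =>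
          sum_strip (fun j => F x a (b - 1) j) (fun j => F x a (b + 1) j) (fun j => F x a b j)
          (fun j hj => hF0 _ _ _ _ (by omega)) (fun j hj => hF0 _ _ _ _ (by omega)) k' hk'
          (fun j hj hj' => by
            have := hclosed x a b j ⟨ha, hb, by omega, Or.inl hAB⟩
            simpa [coboundary, h1, h2, hj] using this)
        have s1 := strip k h3 hk
        have s2 := strip (w x) (hw2 x) (hw x)
        linear_combination s1 + s2 + CharTwo.add_self_eq_zero (F x a b 0)
      · rw [show k = w x from hAB]
        simp only [CharTwo.add_self_eq_zero]
    have e3 := sum_strip (fun j => F x j (b - 1) (w x)) (fun j => F x j (b + 1) (w x))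
      (fun j => F x j b (w x)) (fun j hj => hF0 _ _ _ _ (by have := hw2 x; omega))
      (fun j hj => hF0 _ _ _ _ (by have := hw2 x; omega)) a h1
      (fun j hj hj' => by
        have := hclosed x j b (w x) ⟨by omega, hb, hw x, Or.inr rfl⟩
        have hww := hw2 x
        simp [coboundary, h2, hj, hww] at this
        linear_combination this)
    simp only [coboundary, h1, h2, h3, if_true, V]
    simp only [zero_ne_one, if_false, add_zero, zero_add]
    linear_combination e1 + e2 + e3 + CharTwo.add_self_eq_zero (F x a b (w x)) +
      CharTwo.add_self_eq_zero (F x 0 b (w x))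
  · -- an edge in the last direction
    have e1 := sum_range_edge (fun j => F x a b j) (fun j hj => hF0 _ _ _ _ (by omega)) k h3
    simp only [coboundary, h1, h2, h3, if_true, V]
    simp only [zero_ne_one, if_false, zero_add]
    linear_combination e1 + CharTwo.add_self_eq_zero (∑ j ∈ Finset.range (w x), F x a b j) +
      CharTwo.add_self_eq_zero (∑ j ∈ Finset.range a, F x j b (w x)) +
      CharTwo.add_self_eq_zero (∑ j ∈ Finset.range b, F x 0 j (w x))

/-- The sum of all vertices of the layers, weighted by a chain of `X`-checks. -/
def allX (e : X → ZMod 2) : η.XCell → ZMod 2 := fun c => if gridDim c.1.2 = 0 then e c.1.1 else 0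

theorem dXX_mulVec_allX (e : X → ZMod 2) : η.dXX *ᵥ η.allX e = 0 := by
  have h1 : η.allX e = truncate (fun c : η.XCell => gridDim c.1.2 = 0) (fun c => e c.1.1) := rfl
  rw [h1, mulVec_truncate η.dXX (fun c => gridDim c.1.2 = 0) (fun c => gridDim c.1.2 = 1) (by
    intro t s h
    have := η.dXX_grading t s h
    omega)]
  have h2 : η.dXX *ᵥ (fun c => e c.1.1) = 0 := by
    ext c
    have key := η.dXX_mulVec _ (fun x _ _ _ => e x) (fun _ => rfl) (η.layerX_coords c)
    rw [η.cell_layerX_coords] at key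
    rw [key]
    simp [coboundary, CharTwo.add_self_eq_zero]
  rw [h2]
  ext c
  simp [truncate]

end Coloring

end Layers

end LayerCode

/-- The cocomplex of a CSS code, with the roles of the `X`-checks and the `Z`-checks exchanged. -/
def CSSComplex.transpose {X Q Z : Type*} [Fintype Q] (A : CSSComplex X Q Z) : CSSComplex Z Q X where
  d₂ := A.d₁ᵀ
  d₁ := A.d₂ᵀ
  d₁_mul_d₂ := by rw [← Matrix.transpose_mul, A.d₁_mul_d₂, Matrix.transpose_zero]

namespace LayerCode

section Layers

variable {L : ℕ} {X Z : Type*} [Fintype X] [Fintype Z]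
  {A : CSSComplex X (Fin L × Fin L) Z} {χX χZ : ℕ}

namespace Coloring

/-! ### Exchanging the two types of checks -/

/-- The same colourings, for the transposed code. -/
def transpose (η : Coloring A χX χZ) : Coloring A.transpose χZ χX where
  etaX := η.etaZ
  etaZ := η.etaX
  omegaX := η.omegaZ
  omegaZ := η.omegaX
  lineX := η.lineZ
  lineZ := η.lineX
  planeX := η.planeZ
  planeZ := η.planeX

variable (η : Coloring A χX χZ)

/-- Exchange of the first and the last coordinate: the cells of the `X`-check layers are the cells of
the `Z`-check layers of the transposed code. -/
def swapX : η.XCell ≃ η.transpose.ZCell where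
  toFun c := ⟨(c.1.1, c.1.2.2.2, c.1.2.2.1, c.1.2.1), c.2⟩
  invFun c := ⟨(c.1.1, c.1.2.2.2, c.1.2.2.1, c.1.2.1), c.2⟩
  left_inv _ := rfl
  right_inv _ := rfl

/-- Exchange of the first and the last coordinate, for the `Z`-check layers. -/
def swapZ : η.ZCell ≃ η.transpose.XCell where
  toFun c := ⟨(c.1.1, c.1.2.2.2, c.1.2.2.1, c.1.2.1), c.2⟩
  invFun c := ⟨(c.1.1, c.1.2.2.2, c.1.2.2.1, c.1.2.1), c.2⟩
  left_inv _ := rfl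
  right_inv _ := rfl

/-- Exchange of the first and the last coordinate, for the qubit layers. -/
def swapQ : η.QCell ≃ η.transpose.QCell where
  toFun c := (c.1, c.2.2, c.2.1)
  invFun c := (c.1, c.2.2, c.2.1)
  left_inv _ := rfl
  right_inv _ := rfl

theorem gridD_swap {LX L LZ : ℕ} (i i' : RCell LX) (p p' : PlaneCell L) (k k' : RCell LZ) :
    gridD LZ L LX (k, p, i) (k', p', i') = gridD LX L LZ (i, p, k) (i', p', k') := by
  rw [gridD_apply, gridD_apply]
  by_cases hi : i = i' <;> by_cases hp : p = p' <;> by_cases hk : k = k' <;>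
    simp [hi, hp, hk, add_comm, add_left_comm]

theorem tensorD_swap {m n : ℕ} (i i' : RCell m) (k k' : RCell n) :
    tensorD (repD n) (repD m)ᵀ (k, i) (k', i') = tensorD (repD m) (repD n)ᵀ (i', k') (i, k) := by
  rw [tensorD_apply, tensorD_apply, add_comm]
  simp only [Matrix.transpose_apply]
  exact congrArg₂ _ (if_congr eq_comm rfl rfl) (if_congr eq_comm rfl rfl)

theorem gridDim_swapX (c : η.XCell) : gridDim (η.swapX c).1.2 = gridDim c.1.2 := by
  have h : ∀ a b c : ℕ, a + b + c = c + b + a := fun a b c => by ring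
  exact h _ _ _

theorem gridDim_swapZ (c : η.ZCell) : gridDim (η.swapZ c).1.2 = gridDim c.1.2 := by
  have h : ∀ a b c : ℕ, a + b + c = c + b + a := fun a b c => by ring
  exact h _ _ _

section

variable [DecidableEq X] [DecidableEq Z]

theorem dZZ_swapX (t s : η.XCell) : η.transpose.dZZ (η.swapX t) (η.swapX s) = η.dXX s t := by
  rw [dZZ_apply, dXX_apply]
  exact if_congr eq_comm (gridD_swap _ _ _ _ _ _) rfl

theorem dXX_swapZ (t s : η.ZCell) : η.transpose.dXX (η.swapZ t) (η.swapZ s) = η.dZZ s t := by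
  rw [dZZ_apply, dXX_apply]
  exact if_congr eq_comm (gridD_swap _ _ _ _ _ _) rfl

theorem dQQ_swapQ (t s : η.QCell) : η.transpose.dQQ (η.swapQ t) (η.swapQ s) = η.dQQ s t := by
  rw [dQQ_apply, dQQ_apply]
  exact if_congr eq_comm (tensorD_swap _ _ _ _) rfl

theorem gZQ_swap (t : η.QCell) (s : η.XCell) :
    η.transpose.gZQ (η.swapX s) (η.swapQ t) = η.gQX t s := by
  refine @if_congr _ _ _ _ _ _ _ _ _ ?_ rfl rfl
  exact and_congr Iff.rfl ⟨fun ⟨h1, h2, h3⟩ => ⟨h3, h2, h1⟩, fun ⟨h1, h2, h3⟩ => ⟨h3, h2, h1⟩⟩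

theorem gQX_swap (t : η.ZCell) (s : η.QCell) :
    η.transpose.gQX (η.swapQ s) (η.swapZ t) = η.gZQ t s := by
  refine @if_congr _ _ _ _ _ _ _ _ _ ?_ rfl rfl
  exact and_congr Iff.rfl ⟨fun ⟨h1, h2, h3⟩ => ⟨h3, h2, h1⟩, fun ⟨h1, h2, h3⟩ => ⟨h3, h2, h1⟩⟩

theorem dZZ_transpose : η.dZZᵀ = η.transpose.dXX.submatrix η.swapZ η.swapZ := by
  ext t s
  exact (η.dXX_swapZ t s).symm

/-- The first homology of the `Z`-check layers vanishes. -/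
theorem exists_dZZ_eq (l : η.ZCell → ZMod 2) (hl : ∀ c, l c ≠ 0 → gridDim c.1.2 = 1)
    (hl0 : η.dZZ *ᵥ l = 0) : ∃ s, η.dZZ *ᵥ s = l := by
  rw [← Matrix.transpose_transpose η.dZZ] at hl0 ⊢
  refine exact_transpose η.dZZᵀ (fun c => gridDim c.1.2 = 1) (fun c => gridDim c.1.2 = 2) ?_ ?_ l hl
    hl0
  · intro t s h
    rw [Matrix.transpose_apply, dZZ_apply] at h
    have := gridD_ne_zero (ite_ne_right_iff.1 h).2
    omega
  · intro l hl hl0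
    rw [dZZ_transpose, Matrix.submatrix_mulVec_equiv] at hl0
    obtain ⟨s, -, hs⟩ := η.transpose.exists_dXX_eq (l ∘ η.swapZ.symm)
      (fun c hc => by
        rw [← hl _ hc, ← gridDim_swapZ, Equiv.apply_symm_apply])
      (by
        ext c
        have := congrFun hl0 (η.swapZ.symm c)
        simpa using this)
    refine ⟨s ∘ η.swapZ, ?_⟩
    rw [dZZ_transpose, Matrix.submatrix_mulVec_equiv, Function.comp_assoc, Equiv.self_comp_symm,
      Function.comp_id, hs, Function.comp_assoc, Equiv.symm_comp_self, Function.comp_id]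

/-- The sum of the coefficients at all vertices of a layer `C(z)` vanishes on boundaries. -/
theorem sum_vertices_dZZ (z : Z) (f : η.ZCell → ZMod 2) :
    ∑ c : η.ZCell, (if c.1.1 = z ∧ gridDim c.1.2 = 0 then (η.dZZ *ᵥ f) c else 0) = 0 := by
  let e : Z → ZMod 2 := Pi.single z 1
  have h1 : η.dZZᵀ *ᵥ (η.transpose.allX e ∘ η.swapZ) = 0 := by
    rw [dZZ_transpose, Matrix.submatrix_mulVec_equiv, Function.comp_assoc, Equiv.self_comp_symm,
      Function.comp_id, dXX_mulVec_allX]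
    rfl
  have h2 : (η.transpose.allX e ∘ η.swapZ) ⬝ᵥ (η.dZZ *ᵥ f) = 0 := by
    rw [Matrix.dotProduct_mulVec, ← Matrix.mulVec_transpose, h1, zero_dotProduct]
  refine Eq.trans ?_ h2
  refine Finset.sum_congr rfl fun c _ => ?_
  simp only [Function.comp, allX, gridDim_swapZ, e]
  have h3 : (η.swapZ c).1.1 = c.1.1 := rfl
  rw [h3]
  by_cases hz : c.1.1 = z <;> by_cases hc : gridDim c.1.2 = 0 <;> simp [hz, hc]

/-! ### Homology of the qubit layers -/

theorem sum_repD_right {n : ℕ} (t : RCell n) (g : ℕ → ZMod 2) (hg : g (2 * n - 1) = 0) :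
    ∑ s, repD n t s * g s.val =
      if t.val % 2 = 0 then (if t.val = 0 then 0 else g (t.val - 1)) + g (t.val + 1) else 0 := by
  have ht := t.2
  by_cases h : t.val % 2 = 0
  · rw [if_pos h]
    have h1 : ∀ s : RCell n, repD n t s * g s.val =
        (if t.val = s.val + 1 then g s.val else 0) + (if t.val + 1 = s.val then g s.val else 0) := by
      intro s
      simp only [repD, Matrix.of_apply, rdim]
      by_cases h2 : t.val = s.val + 1
      · have h3 : ¬ t.val + 1 = s.val := by omega
        have h4 : s.val % 2 = 1 := by omega
        have h5 : ¬ s.val + 1 + 1 = s.val := by omega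
        simp [h2, h4, h5]
      · by_cases h3 : t.val + 1 = s.val
        · have h4 : s.val % 2 = 1 := by omega
          simp [h2, h3, h4]
        · simp [h2, h3]
    simp only [h1, Finset.sum_add_distrib]
    congr 1
    · by_cases h0 : t.val = 0
      · rw [if_pos h0]
        refine Finset.sum_eq_zero fun s _ => if_neg (by omega)
      · rw [if_neg h0, Finset.sum_eq_single ⟨t.val - 1, by omega⟩]
        · exact if_pos (by simp only; omega)
        · intro s _ hs
          refine if_neg fun hc => hs (Fin.ext ?_)
          simp only
          omega
        · simp
    · by_cases h0 : t.val + 1 < 2 * n - 1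
      · rw [Finset.sum_eq_single ⟨t.val + 1, h0⟩]
        · simp
        · intro s _ hs
          exact if_neg fun hc => hs (Fin.ext hc.symm)
        · simp
      · rw [show t.val + 1 = 2 * n - 1 by omega, hg]
        refine Finset.sum_eq_zero fun s _ => if_neg ?_
        have := s.2
        omega
  · rw [if_neg h]
    refine Finset.sum_eq_zero fun s _ => ?_
    by_contra hc
    have := repD_odd (left_ne_zero_of_mul hc)
    have h2 := repD_ne_zero (left_ne_zero_of_mul hc)
    unfold rdim at h2
    omega

theorem dQQ_mulVec (f : η.QCell → ZMod 2) (V : Fin L × Fin L → ℕ → ℕ → ZMod 2)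
    (hf : ∀ c, f c = V c.1 c.2.1 c.2.2) (q : Fin L × Fin L) (i : RCell η.LX) (k : RCell η.LZ)
    (hV : V q (2 * η.LX - 1) k = 0) :
    (η.dQQ *ᵥ f) (q, i, k) =
      (if i.val % 2 = 0 then (if i.val = 0 then 0 else V q (i.val - 1) k) + V q (i.val + 1) k
        else 0) + coboundary (fun j => V q i j) k := by
  have h1 : (η.dQQ *ᵥ f) (q, i, k) =
      ∑ s, tensorD (repD η.LX) (repD η.LZ)ᵀ (i, k) s * V q s.1 s.2 := by
    simp only [Matrix.mulVec, dotProduct, dQQ_apply, hf]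
    rw [Fintype.sum_prod_type, Finset.sum_eq_single q]
    · simp
    · intro q' _ hq
      simp [Ne.symm hq]
    · simp
  rw [h1, sum_tensorD_right _ _ _ fun s : RCell η.LX × RCell η.LZ => V q s.1 s.2]
  rw [sum_repD_right i (fun j => V q j k) hV]
  exact congrArg₂ _ rfl (sum_repD_left k fun j => V q i j)

/-- A chain of the qubit layers as a function of the doubled coordinates, extended by zero. -/
def coordQ (f : η.QCell → ZMod 2) (q : Fin L × Fin L) (i k : ℕ) : ZMod 2 :=
  if h : i < 2 * η.LX - 1 ∧ k < 2 * η.LZ - 1 then f (q, ⟨i, h.1⟩, ⟨k, h.2⟩) else 0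

theorem coordQ_coords (f : η.QCell → ZMod 2) (c : η.QCell) :
    η.coordQ f c.1 c.2.1 c.2.2 = f c :=
  dif_pos ⟨c.2.1.2, c.2.2.2⟩

/-- The coefficient of a chain on the qubit layer of `q` at height `k`. -/
def sliceQ (f : η.QCell → ZMod 2) (q : Fin L × Fin L) (k : ℕ) : ZMod 2 :=
  ∑ i ∈ Finset.range (2 * η.LX - 1), η.coordQ f q i k

theorem coordQ_eq_zero (l : η.QCell → ZMod 2)
    (hl : ∀ c, l c ≠ 0 → rdim c.2.1 + (1 - rdim c.2.2) = 1) (q : Fin L × Fin L) (i k : ℕ)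
    (h : i % 2 ≠ k % 2) : η.coordQ l q i k = 0 := by
  by_contra hc
  unfold coordQ at hc
  split_ifs at hc with h1
  · have := hl _ hc
    simp only [rdim] at this
    omega
  · exact hc rfl

/-- The edge coefficients of a cycle of the qubit layers compare neighbouring heights. -/
theorem sum_range_coordQ (l : η.QCell → ZMod 2)
    (hl : ∀ c, l c ≠ 0 → rdim c.2.1 + (1 - rdim c.2.2) = 1) (hl0 : η.dQQ *ᵥ l = 0)
    (q : Fin L × Fin L) (k : ℕ) (hk : k < 2 * η.LZ - 1) (hk1 : k % 2 = 1) (i : ℕ)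
    (hi : i ≤ 2 * η.LX - 1) (hi1 : i % 2 = 1) :
    ∑ j ∈ Finset.range i, η.coordQ l q j (k - 1) + ∑ j ∈ Finset.range i, η.coordQ l q j (k + 1) =
      η.coordQ l q i k := by
  set F := η.coordQ l with hF
  have hF0 : ∀ i k, i % 2 ≠ k % 2 → F q i k = 0 := η.coordQ_eq_zero l hl q
  have hcl : ∀ i, i < 2 * η.LX - 1 → i % 2 = 0 →
      (if i = 0 then 0 else F q (i - 1) k) + F q (i + 1) k + (F q i (k - 1) + F q i (k + 1)) = 0 := by
    intro i hi hi0
    have := η.dQQ_mulVec l F (fun c => (η.coordQ_coords l c).symm) q ⟨i, hi⟩ ⟨k, hk⟩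
      (dif_neg fun h => absurd h.1 (lt_irrefl _))
    rw [hl0] at this
    simpa [coboundary, hk1, hi0] using this.symm
  obtain ⟨t, rfl⟩ : ∃ t, i = 2 * t + 1 := ⟨i / 2, by omega⟩
  induction t with
  | zero =>
    have := hcl 0 (by omega) rfl
    simp only [if_true, zero_add] at this
    simp only [mul_zero, zero_add, Finset.sum_range_one]
    linear_combination this - CharTwo.add_self_eq_zero (F q 1 k)
  | succ t ih =>
    have ih' := ih (by omega) (by omega)
    have h1 := hcl (2 * t + 2) (by omega) (by omega)
    rw [if_neg (by omega)] at h1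
    rw [show 2 * (t + 1) + 1 = 2 * t + 1 + 1 + 1 by ring]
    simp only [Finset.sum_range_succ, hF0 (2 * t + 1) (k - 1) (by omega),
      hF0 (2 * t + 1) (k + 1) (by omega)] at ih' ⊢
    rw [show 2 * t + 2 - 1 = 2 * t + 1 by omega] at h1
    linear_combination ih' + h1 - CharTwo.add_self_eq_zero (F q (2 * t + 1 + 1 + 1) k)

/-- The coefficients of a cycle on the qubit layers do not depend on the height. -/
theorem sliceQ_eq (hLX : 0 < η.LX) (l : η.QCell → ZMod 2)
    (hl : ∀ c, l c ≠ 0 → rdim c.2.1 + (1 - rdim c.2.2) = 1) (hl0 : η.dQQ *ᵥ l = 0)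
    (q : Fin L × Fin L) (k : ℕ) (hk : k < η.LZ) : η.sliceQ l q (2 * k) = η.sliceQ l q 0 := by
  induction k with
  | zero => rfl
  | succ k ih =>
    rw [← ih (by omega)]
    have h1 := η.sum_range_coordQ l hl hl0 q (2 * k + 1) (by omega) (by omega) (2 * η.LX - 1)
      le_rfl (by omega)
    have h2 : η.coordQ l q (2 * η.LX - 1) (2 * k + 1) = 0 :=
      dif_neg fun h => absurd h.1 (lt_irrefl _)
    rw [h2] at h1
    simp only [sliceQ]
    rw [Nat.add_sub_cancel, show 2 * k + 1 + 1 = 2 * (k + 1) by ring] at h1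
    exact (CharTwo.add_eq_zero.1 h1).symm

/-- A cycle on the qubit layers all of whose coefficients vanish is a boundary. -/
theorem exists_dQQ_eq (l : η.QCell → ZMod 2)
    (hl : ∀ c, l c ≠ 0 → rdim c.2.1 + (1 - rdim c.2.2) = 1) (hl0 : η.dQQ *ᵥ l = 0)
    (hs : ∀ q k, k < η.LZ → η.sliceQ l q (2 * k) = 0) :
    ∃ s, (∀ c, s c ≠ 0 → rdim c.2.1 + (1 - rdim c.2.2) = 2) ∧ η.dQQ *ᵥ s = l := by
  set F := η.coordQ l with hF
  have hF0 : ∀ q i k, i % 2 ≠ k % 2 → F q i k = 0 := η.coordQ_eq_zero l hl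
  let V : Fin L × Fin L → ℕ → ℕ → ZMod 2 := fun q i k => ∑ j ∈ Finset.range i, F q j k
  refine ⟨truncate (fun c : η.QCell => rdim c.2.1 + (1 - rdim c.2.2) = 2)
    (fun c => V c.1 c.2.1 c.2.2), fun c => of_truncate_ne_zero, ?_⟩
  rw [mulVec_truncate η.dQQ (fun c => rdim c.2.1 + (1 - rdim c.2.2) = 2)
    (fun c => rdim c.2.1 + (1 - rdim c.2.2) = 1) (by
      intro t s h
      have : η.deg (.inr (.inl s)) = η.deg (.inr (.inl t)) + 1 := η.deg_of_totalD_ne_zero h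
      simp only [deg] at this
      omega)]
  ext ⟨q, i, k⟩
  by_cases hc : rdim i + (1 - rdim k) = 1
  swap
  · rw [truncate, if_neg hc]
    by_contra h0
    exact hc (hl _ (Ne.symm h0))
  rw [truncate, if_pos hc]
  unfold rdim at hc
  rw [← η.coordQ_coords l (q, i, k), ← hF]
  simp only
  rcases (show k.val % 2 = 0 ∨ k.val % 2 = 1 by omega) with hk | hk
  · have hi : i.val % 2 = 0 := by omega
    rw [η.dQQ_mulVec _ V (fun _ => rfl) q i k (by
      have := hs q (k.val / 2) (by have := k.2; omega)
      rwa [show 2 * (k.val / 2) = k.val by omega] at this)]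
    simp only [coboundary, hi, hk, if_true, V]
    simp only [zero_ne_one, if_false, add_zero]
    by_cases h0 : i.val = 0
    · simp [h0]
    · rw [if_neg h0]
      obtain ⟨t, ht⟩ : ∃ t, i.val = t + 1 := ⟨i.val - 1, by omega⟩
      rw [ht, Nat.add_sub_cancel, Finset.sum_range_succ, Finset.sum_range_succ,
        hF0 q t k (by omega)]
      linear_combination CharTwo.add_self_eq_zero (∑ j ∈ Finset.range t, F q j k)
  · have hi : i.val % 2 = 1 := by omega
    have h1 : ∑ s, tensorD (repD η.LX) (repD η.LZ)ᵀ (i, k) s * V q s.1 s.2 = F q i k := by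
      rw [sum_tensorD_right _ _ _ fun s : RCell η.LX × RCell η.LZ => V q s.1 s.2]
      have h2 : ∑ a, repD η.LX i a * V q a k = 0 := by
        refine Finset.sum_eq_zero fun a _ => ?_
        by_contra hc
        have h3 := repD_ne_zero (left_ne_zero_of_mul hc)
        unfold rdim at h3
        omega
      have h4 := sum_repD_left k fun j => V q i j
      simp only [Matrix.transpose_apply]
      rw [h2, h4, zero_add, coboundary, if_pos hk]
      exact η.sum_range_coordQ l hl hl0 q k k.2 hk i i.2.le hi
    rw [← h1]
    simp only [Matrix.mulVec, dotProduct, dQQ_apply]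
    rw [Fintype.sum_prod_type, Finset.sum_eq_single q]
    · simp
    · intro q' _ hq
      simp [Ne.symm hq]
    · simp

end

end Coloring

end Layers

/-! ### Cycles and heights -/

theorem exists_coboundary_ne_zero (g : ℕ → ZMod 2) {a a' : ℕ} (ha : a % 2 = 0) (ha' : a' % 2 = 0)
    (h : g a ≠ g a') : ∃ e, e % 2 = 1 ∧ e < max a a' ∧ coboundary g e ≠ 0 := by
  by_contra! hc
  have key : ∀ t, 2 * t ≤ max a a' → g (2 * t) = g 0 := by
    intro t
    induction t with
    | zero => exact fun _ => rfl
    | succ t ih =>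
      intro ht
      have h1 := hc (2 * t + 1) (by omega) (by omega)
      rw [coboundary, if_pos (by omega)] at h1
      rw [← ih (by omega)]
      exact (CharTwo.add_eq_zero.1 h1).symm
  apply h
  have h1 := key (a / 2) (by omega)
  have h2 := key (a' / 2) (by omega)
  rw [show 2 * (a / 2) = a by omega] at h1
  rw [show 2 * (a' / 2) = a' by omega] at h2
  rw [h1, h2]

theorem zmod_two_eq_ite (a : ZMod 2) : a = if a ≠ 0 then 1 else 0 := by
  revert a
  decide

section Layers

variable {L : ℕ} {X Z : Type*} [Fintype X] [Fintype Z]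
  {A : CSSComplex X (Fin L × Fin L) Z} {χX χZ : ℕ}

namespace Coloring

variable (η : Coloring A χX χZ)

theorem mulVec_d₂ (e : X → ZMod 2) (q : Fin L × Fin L) :
    (A.d₂ *ᵥ e) q = ∑ x, if q ∈ A.suppX x then e x else 0 := by
  have h : (A.d₂ *ᵥ e) q = ∑ x, A.d₂ q x * e x := rfl
  rw [h]
  refine Finset.sum_congr rfl fun x _ => ?_
  rw [zmod_two_eq_ite (A.d₂ q x)]
  simp [CSSComplex.suppX]

theorem mulVec_d₁ (e : Fin L × Fin L → ZMod 2) (z : Z) :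
    (A.d₁ *ᵥ e) z = ∑ q, if q ∈ A.suppZ z then e q else 0 := by
  have h : (A.d₁ *ᵥ e) z = ∑ q, A.d₁ z q * e q := rfl
  rw [h]
  refine Finset.sum_congr rfl fun q _ => ?_
  rw [zmod_two_eq_ite (A.d₁ z q)]
  simp [CSSComplex.suppZ]

variable [DecidableEq X] [DecidableEq Z]

theorem sliceQ_eq_sum (f : η.QCell → ZMod 2) (q : Fin L × Fin L) (k : RCell η.LZ) :
    η.sliceQ f q k = ∑ i, f (q, i, k) := by
  unfold sliceQ
  rw [Finset.sum_range]
  exact Finset.sum_congr rfl fun i _ => η.coordQ_coords f (q, i, k)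

/-- The height `k`, in doubled coordinates. -/
def height (k : ℕ) (hk : k < η.LZ) : RCell η.LZ := ⟨2 * k, by omega⟩

theorem sliceQ_add (f g : η.QCell → ZMod 2) (q : Fin L × Fin L) (k : ℕ) (hk : k < η.LZ) :
    η.sliceQ (f + g) q (2 * k) = η.sliceQ f q (2 * k) + η.sliceQ g q (2 * k) := by
  have h := fun f => η.sliceQ_eq_sum f q (η.height k hk)
  simp only [height] at h
  simp only [h, Pi.add_apply, Finset.sum_add_distrib]

theorem sliceQ_gQX (s : η.XCell → ZMod 2) (q : Fin L × Fin L) (k : ℕ) (hk : k < η.LZ) :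
    η.sliceQ (η.gQX *ᵥ s) q (2 * k) =
      ∑ x, if q ∈ A.suppX x then η.coordX s x (qpos q).1 (qpos q).2 (2 * k) else 0 := by
  have h1 : ∀ i, (η.gQX *ᵥ s) (q, i, η.height k hk) = ∑ x, if i = η.posX x then
      (if q ∈ A.suppX x then η.coordX s x (qpos q).1 (qpos q).2 (2 * k) else 0) else 0 := by
    intro i
    set G : X × η.Grid → ZMod 2 := fun c => if c.2.1 = i then if c.2.2.1 = qcell q then
      if c.2.2.2 = η.height k hk then if i = η.posX c.1 then if q ∈ A.suppX c.1 then
        η.coordX s c.1 (qpos q).1 (qpos q).2 (2 * k) else 0 else 0 else 0 else 0 else 0 with hG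
    have h2 : (η.gQX *ᵥ s) (q, i, η.height k hk) = ∑ c : η.XCell, G c.1 := by
      refine Finset.sum_congr rfl fun c _ => ?_
      rw [← η.coordX_coords s c]
      have hc := c.2
      obtain ⟨⟨x, i', p, k'⟩, hlay⟩ := c
      have hi : i' = η.posX x := Fin.ext hlay.1
      simp only [gQX, Matrix.of_apply, hG, qpos_eq_iff]
      by_cases e1 : i' = i
      · by_cases e2 : p = qcell q
        · by_cases e3 : k' = η.height k hk
          · subst e1 e2 e3
            by_cases e4 : q ∈ A.suppX x
            · simp only [e4, hi, if_true, true_and, one_mul]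
              rfl
            · simp [e4]
          · simp [e3]
        · simp [e2]
      · simp [e1]
    rw [h2, sum_subtype_of_support (fun c : X × η.Grid => η.InLayerX c.1 c.2) G]
    · simp [Fintype.sum_prod_type, hG]
    · rintro ⟨x, i', p, k'⟩ hc
      simp only [hG] at hc
      split_ifs at hc with e1 e2 e3 e4 e5
      · subst e1 e2 e3
        exact η.inLayerX_qcell e5 _ (by rw [e4]; rfl) _
      all_goals exact absurd rfl hc
  have h3 := η.sliceQ_eq_sum (η.gQX *ᵥ s) q (η.height k hk)
  simp only [h1] at h3
  rw [Finset.sum_comm] at h3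
  simpa [height] using h3

theorem sum_vertices_gZQ (z : Z) (f : η.QCell → ZMod 2)
    (hf : ∀ c, f c ≠ 0 → rdim c.2.1 + (1 - rdim c.2.2) = 1) :
    ∑ c : η.ZCell, (if c.1.1 = z ∧ gridDim c.1.2 = 0 then (η.gZQ *ᵥ f) c else 0) =
      ∑ q, if q ∈ A.suppZ z then η.sliceQ f q (2 * (η.etaZ z).val) else 0 := by
  have hk : (η.etaZ z).val < η.LZ := lt_of_lt_of_le (η.etaZ z).2 (le_max_left _ _)
  have h1 : ∀ t : η.QCell, ∑ c : η.ZCell,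
      (if c.1.1 = z ∧ gridDim c.1.2 = 0 then η.gZQ c t * f t else 0) =
      if t.2.2 = η.height _ hk then if t.1 ∈ A.suppZ z then f t else 0 else 0 := by
    rintro ⟨q, i, k⟩
    by_cases hf0 : f (q, i, k) = 0
    · simp [hf0]
    have hdim := hf _ hf0
    simp only [rdim] at hdim
    by_cases hq : q ∈ A.suppZ z ∧ k = η.height _ hk
    · obtain ⟨hq, rfl⟩ := hq
      rw [if_pos rfl, if_pos hq]
      rw [Finset.sum_eq_single ⟨(z, i, qcell q, η.height _ hk), η.inLayerZ_qcell hq i _ rfl⟩]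
      · rw [if_pos]
        · simp [gZQ, hq, qpos_eq_iff]
        · refine ⟨rfl, ?_⟩
          simp only [gridDim, planeDim, rdim, qcell, height] at hdim ⊢
          omega
      · rintro ⟨⟨z', i', p, k'⟩, hc⟩ - hne
        by_cases hz : z' = z
        · subst hz
          rw [gZQ, Matrix.of_apply, if_neg (t := (1 : ZMod 2)), zero_mul, ite_self]
          rintro ⟨-, e1, e2, e3⟩
          simp only [qpos_eq_iff] at e1 e2 e3
          subst e1 e2 e3
          exact hne rfl
        · exact if_neg fun h => hz h.1
      · exact fun h => absurd (Finset.mem_univ _) h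
    · have h2 : (if k = η.height _ hk then if q ∈ A.suppZ z then f (q, i, k) else 0 else 0) = 0 := by
        rw [← ite_and]
        exact if_neg fun h => hq h.symm
      refine Eq.trans (Finset.sum_eq_zero ?_) h2.symm
      rintro ⟨⟨z', i', p, k'⟩, hc⟩ -
      by_cases hz : z' = z
      · subst hz
        rw [gZQ, Matrix.of_apply, if_neg (t := (1 : ZMod 2)), zero_mul, ite_self]
        rintro ⟨e0, -, -, e3⟩
        refine hq ⟨e0, e3.symm.trans (Fin.ext hc.1)⟩
      · exact if_neg fun h => hz h.1
  have h2 : ∀ c : η.ZCell, (if c.1.1 = z ∧ gridDim c.1.2 = 0 then (η.gZQ *ᵥ f) c else 0) =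
      ∑ t, if c.1.1 = z ∧ gridDim c.1.2 = 0 then η.gZQ c t * f t else 0 := by
    intro c
    split_ifs with h
    · rfl
    · simp
  simp only [h2]
  rw [Finset.sum_comm]
  simp only [h1]
  rw [Fintype.sum_prod_type]
  refine Finset.sum_congr rfl fun q _ => ?_
  rw [Fintype.sum_prod_type, show 2 * (η.etaZ z).val = (η.height _ hk).val from rfl, sliceQ_eq_sum]
  split_ifs with hq <;> simp

/-- The differential of the Layer Code with an arbitrary defect map `P`. For the distance only
the degree of `P` and the vanishing of the square matter, and in this generality the transposed code
is of the same kind. -/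
def totalOf (P : Matrix η.ZCell η.XCell (ZMod 2)) : Matrix η.Cell η.Cell (ZMod 2) :=
  Matrix.fromBlocks η.dXX 0 (Matrix.fromRows η.gQX P) (Matrix.fromBlocks η.dQQ 0 η.gZQ η.dZZ)

theorem totalOf_mulVec (P : Matrix η.ZCell η.XCell (ZMod 2)) (a : η.XCell → ZMod 2)
    (b : η.QCell → ZMod 2) (c : η.ZCell → ZMod 2) :
    η.totalOf P *ᵥ Sum.elim a (Sum.elim b c) =
      Sum.elim (η.dXX *ᵥ a) (Sum.elim (η.gQX *ᵥ a + η.dQQ *ᵥ b)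
        (P *ᵥ a + (η.gZQ *ᵥ b + η.dZZ *ᵥ c))) := by
  unfold totalOf
  rw [Matrix.fromBlocks_mulVec, Matrix.fromRows_mulVec]
  simp only [Sum.elim_comp_inl, Sum.elim_comp_inr, Matrix.zero_mulVec, add_zero,
    Matrix.fromBlocks_mulVec]
  congr 1
  ext (t | t) <;> simp

theorem elim_components (l : η.Cell → ZMod 2) :
    Sum.elim (l ∘ Sum.inl) (Sum.elim (l ∘ Sum.inr ∘ Sum.inl) (l ∘ Sum.inr ∘ Sum.inr)) = l := by
  ext (c | c | c) <;> rfl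

theorem elim_add_elim (a a' : η.XCell → ZMod 2) (b b' : η.QCell → ZMod 2) (c c' : η.ZCell → ZMod 2) :
    Sum.elim a (Sum.elim b c) + Sum.elim a' (Sum.elim b' c') =
      Sum.elim (a + a') (Sum.elim (b + b') (c + c')) := by
  ext (t | t | t) <;> rfl

theorem elim_eq_zero {a : η.XCell → ZMod 2} {b : η.QCell → ZMod 2} {c : η.ZCell → ZMod 2}
    (h : Sum.elim a (Sum.elim b c) = 0) : a = 0 ∧ b = 0 ∧ c = 0 :=
  ⟨funext fun t => congrFun h (.inl t), funext fun t => congrFun h (.inr (.inl t)),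
    funext fun t => congrFun h (.inr (.inr t))⟩

theorem add_self_fun {α : Type*} (f : α → ZMod 2) : f + f = 0 :=
  funext fun _ => CharTwo.add_self_eq_zero _

theorem gQX_grading {t : η.QCell} {s : η.XCell} (h : η.gQX t s ≠ 0) (hs : gridDim s.1.2 = 0) :
    rdim t.2.1 + (1 - rdim t.2.2) = 1 := by
  have h1 : η.deg (.inl s) = η.deg (.inr (.inl t)) + 1 :=
    η.deg_of_totalD_ne_zero (show η.totalD (.inr (.inl t)) (.inl s) ≠ 0 from h)
  simp only [deg] at h1
  omega

theorem gZQ_grading {t : η.ZCell} {s : η.QCell} (h : η.gZQ t s ≠ 0)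
    (hs : rdim s.2.1 + (1 - rdim s.2.2) = 2) : gridDim t.1.2 = 1 := by
  have h1 : η.deg (.inr (.inl s)) = η.deg (.inr (.inr t)) + 1 :=
    η.deg_of_totalD_ne_zero (show η.totalD (.inr (.inr t)) (.inr (.inl s)) ≠ 0 from h)
  simp only [deg] at h1
  omega

theorem exists_ne_zero_of_mulVec {α β : Type*} [Fintype β] {M : Matrix α β (ZMod 2)}
    {f : β → ZMod 2} {t : α} (h : (M *ᵥ f) t ≠ 0) : ∃ s, M t s ≠ 0 ∧ f s ≠ 0 := by
  obtain ⟨s, -, hs⟩ := Finset.exists_ne_zero_of_sum_ne_zero h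
  exact ⟨s, left_ne_zero_of_mul hs, right_ne_zero_of_mul hs⟩

theorem add_ne_zero_cases {a b : ZMod 2} (h : a + b ≠ 0) : a ≠ 0 ∨ b ≠ 0 := by
  by_contra! hc
  exact h (by rw [hc.1, hc.2, add_zero])

/-- A cycle without component on the `X`-check layers, all of whose coefficients on the qubit
layers vanish, is a boundary, since the `Z`-check layers have no first homology. -/
theorem exists_totalOf_eq (P : Matrix η.ZCell η.XCell (ZMod 2))
    (hP : η.totalOf P * η.totalOf P = 0) (b : η.QCell → ZMod 2) (c : η.ZCell → ZMod 2)
    (hb : ∀ t, b t ≠ 0 → rdim t.2.1 + (1 - rdim t.2.2) = 1)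
    (hc : ∀ t, c t ≠ 0 → gridDim t.1.2 = 1)
    (h0 : η.totalOf P *ᵥ Sum.elim (0 : η.XCell → ZMod 2) (Sum.elim b c) = 0)
    (hslice : ∀ q k, k < η.LZ → η.sliceQ b q (2 * k) = 0) :
    ∃ S, η.totalOf P *ᵥ S = Sum.elim (0 : η.XCell → ZMod 2) (Sum.elim b c) := by
  have hb0 : η.dQQ *ᵥ b = 0 := by
    rw [totalOf_mulVec] at h0
    simpa using (η.elim_eq_zero h0).2.1
  obtain ⟨t, ht, rfl⟩ := η.exists_dQQ_eq b hb hb0 hslice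
  have h1 : η.dZZ *ᵥ (c + η.gZQ *ᵥ t) = 0 := by
    have h2 : η.totalOf P *ᵥ (η.totalOf P *ᵥ Sum.elim (0 : η.XCell → ZMod 2) (Sum.elim t 0)) = 0 := by
      rw [Matrix.mulVec_mulVec, hP, Matrix.zero_mulVec]
    have h3 : η.totalOf P *ᵥ (Sum.elim (0 : η.XCell → ZMod 2) (Sum.elim (η.dQQ *ᵥ t) c) +
        η.totalOf P *ᵥ Sum.elim (0 : η.XCell → ZMod 2) (Sum.elim t 0)) = 0 := by
      rw [Matrix.mulVec_add, h0, h2, add_zero]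
    rw [totalOf_mulVec η P 0 t 0, elim_add_elim, totalOf_mulVec] at h3
    have h4 := (η.elim_eq_zero h3).2.2
    simpa [add_self_fun] using h4
  obtain ⟨u, hu⟩ := η.exists_dZZ_eq _ (by
    intro d hd
    rcases add_ne_zero_cases hd with hd | hd
    · exact hc d hd
    · obtain ⟨s, hs1, hs2⟩ := exists_ne_zero_of_mulVec hd
      exact η.gZQ_grading hs1 (ht s hs2)) h1
  refine ⟨Sum.elim (0 : η.XCell → ZMod 2) (Sum.elim t u), ?_⟩
  rw [totalOf_mulVec, hu]
  simp only [Matrix.mulVec_zero, zero_add]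
  congr 2
  rw [add_left_comm, add_self_fun, add_zero]

/-- A cycle is homologous to a cycle of the qubit and `Z`-check layers, whose coefficients on the
qubit layers form a cycle of `A`. The cycle is a boundary if these coefficients are. -/
theorem cycle_of_slices (P : Matrix η.ZCell η.XCell (ZMod 2))
    (hP : η.totalOf P * η.totalOf P = 0)
    (hPdim : ∀ t s, P t s ≠ 0 → gridDim t.1.2 + gridDim s.1.2 = 1)
    (hLX : 0 < η.LX) (l : η.Cell → ZMod 2) (hl : ∀ c, l c ≠ 0 → η.deg c = 1)
    (hl0 : η.totalOf P *ᵥ l = 0) (hne : ¬ ∃ S, η.totalOf P *ᵥ S = l) (s : η.XCell → ZMod 2)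
    (hs : ∀ c, s c ≠ 0 → gridDim c.1.2 = 0) (hsl : η.dXX *ᵥ s = l ∘ Sum.inl)
    (k : ℕ) (hk : k < η.LZ) (a : Fin L × Fin L → ZMod 2)
    (ha : ∀ q, a q = η.sliceQ (l ∘ Sum.inr ∘ Sum.inl + η.gQX *ᵥ s) q (2 * k)) :
    A.d₁ *ᵥ a = 0 ∧ ¬ ∃ e, A.d₂ *ᵥ e = a := by
  -- the cycle `l + ∂s'`, for any vertex chain `s'` with the same coboundary as `s`
  have key : ∀ s', (∀ c, s' c ≠ 0 → gridDim c.1.2 = 0) → η.dXX *ᵥ s' = l ∘ Sum.inl →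
      ∃ b c, b = l ∘ Sum.inr ∘ Sum.inl + η.gQX *ᵥ s' ∧
        l + η.totalOf P *ᵥ Sum.elim s' (Sum.elim 0 0) = Sum.elim (0 : η.XCell → ZMod 2) (Sum.elim b c) ∧
        η.totalOf P *ᵥ Sum.elim (0 : η.XCell → ZMod 2) (Sum.elim b c) = 0 ∧
        (∀ t, b t ≠ 0 → rdim t.2.1 + (1 - rdim t.2.2) = 1) ∧
        (∀ t, c t ≠ 0 → gridDim t.1.2 = 1) := by
    intro s' hs' hsl'
    refine ⟨_, l ∘ Sum.inr ∘ Sum.inr + P *ᵥ s', rfl, ?_⟩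
    have h1 : l + η.totalOf P *ᵥ Sum.elim s' (Sum.elim 0 0) =
        Sum.elim (0 : η.XCell → ZMod 2) (Sum.elim (l ∘ Sum.inr ∘ Sum.inl + η.gQX *ᵥ s')
          (l ∘ Sum.inr ∘ Sum.inr + P *ᵥ s')) := by
      conv_lhs => rw [← η.elim_components l]
      rw [totalOf_mulVec, elim_add_elim, hsl', add_self_fun]
      simp
    refine ⟨h1, ?_, ?_, ?_⟩
    · rw [← h1, Matrix.mulVec_add, hl0, Matrix.mulVec_mulVec, hP, Matrix.zero_mulVec, add_zero]
    · intro t ht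
      rcases add_ne_zero_cases ht with ht | ht
      · exact hl _ ht
      · obtain ⟨c, hc1, hc2⟩ := exists_ne_zero_of_mulVec ht
        exact η.gQX_grading hc1 (hs' c hc2)
    · intro t ht
      rcases add_ne_zero_cases ht with ht | ht
      · exact hl _ ht
      · obtain ⟨c, hc1, hc2⟩ := exists_ne_zero_of_mulVec ht
        have := hPdim _ _ hc1
        have := hs' c hc2
        omega
  have hconst : ∀ b c, η.totalOf P *ᵥ Sum.elim (0 : η.XCell → ZMod 2) (Sum.elim b c) = 0 →
      (∀ t, b t ≠ 0 → rdim t.2.1 + (1 - rdim t.2.2) = 1) → ∀ q k', k' < η.LZ →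
      η.sliceQ b q (2 * k') = η.sliceQ b q (2 * k) := by
    intro b c h0 hb q k' hk'
    rw [totalOf_mulVec] at h0
    have hb0 : η.dQQ *ᵥ b = 0 := by simpa using (η.elim_eq_zero h0).2.1
    rw [η.sliceQ_eq hLX b hb hb0 q k' hk', η.sliceQ_eq hLX b hb hb0 q k hk]
  constructor
  · obtain ⟨b, c, rfl, -, h0, hb, hc⟩ := key s hs hsl
    ext z
    have h1 : η.gZQ *ᵥ (l ∘ Sum.inr ∘ Sum.inl + η.gQX *ᵥ s) = η.dZZ *ᵥ c := by
      rw [totalOf_mulVec] at h0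
      have h2 := (η.elim_eq_zero h0).2.2
      rw [Matrix.mulVec_zero, zero_add] at h2
      ext t
      exact CharTwo.add_eq_zero.1 (congrFun h2 t)
    have h2 := η.sum_vertices_gZQ z _ hb
    rw [h1, sum_vertices_dZZ] at h2
    rw [mulVec_d₁, Pi.zero_apply]
    refine Eq.trans ?_ h2.symm
    refine Finset.sum_congr rfl fun q _ => if_congr Iff.rfl ?_ rfl
    rw [ha]
    exact (hconst _ c h0 hb q _ (lt_of_lt_of_le (η.etaZ z).2 (le_max_left _ _))).symm
  · rintro ⟨e, he⟩
    obtain ⟨b, c, hbdef, h1, h0, hb, hc⟩ := key (s + η.allX e)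
      (by
        intro c hc
        rcases add_ne_zero_cases hc with hc | hc
        · exact hs c hc
        · exact (ite_ne_right_iff.1 hc).1)
      (by rw [Matrix.mulVec_add, dXX_mulVec_allX, add_zero, hsl])
    have hslice : ∀ q k', k' < η.LZ → η.sliceQ b q (2 * k') = 0 := by
      intro q k' hk'
      rw [hconst b c h0 hb q k' hk', hbdef, Matrix.mulVec_add, ← add_assoc, sliceQ_add _ _ _ _ _ hk,
        ← ha, ← he, mulVec_d₂, sliceQ_gQX _ _ _ _ hk, CharTwo.add_eq_zero]
      refine Finset.sum_congr rfl fun x _ => ?_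
      by_cases hq : q ∈ A.suppX x
      · rw [if_pos hq, if_pos hq]
        have hlay : η.LayerX x (qpos q).1 (qpos q).2 (2 * k) :=
          ⟨(qcell q).1.2, (qcell q).2.2, (η.height k hk).2, Or.inl ⟨q, hq, Or.inl rfl⟩⟩
        rw [coordX_cell _ _ hlay, allX, if_pos]
        · rfl
        · rw [gridDim_cell]
          simp [qpos]
      · rw [if_neg hq, if_neg hq]
    obtain ⟨S, hS⟩ := η.exists_totalOf_eq P hP b c hb hc h0 hslice
    refine hne ⟨S + Sum.elim (s + η.allX e) (Sum.elim 0 0), ?_⟩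
    rw [Matrix.mulVec_add, hS, ← h1, add_assoc, add_self_fun, add_zero]

/-- Within a height, a vertex chain of `C(x)` that takes different values at two qubits of `x` has
a coboundary edge. -/
theorem exists_edge_of_ne (s : η.XCell → ZMod 2) (x : X) (k : ℕ) (hk : k < η.LZ)
    {q q' : Fin L × Fin L} (hq : q ∈ A.suppX x) (hq' : q' ∈ A.suppX x)
    (h : η.coordX s x (qpos q).1 (qpos q).2 (2 * k) ≠ η.coordX s x (qpos q').1 (qpos q').2 (2 * k)) :
    ∃ c : η.XCell, c.1.1 = x ∧ c.1.2.2.2.val = 2 * k ∧ (η.dXX *ᵥ s) c ≠ 0 := by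
  have hk' := (η.height k hk).2
  have b1 := (qcell q).1.2
  have b2 := (qcell q).2.2
  have b1' := (qcell q').1.2
  have b2' := (qcell q').2.2
  simp only [height, qcell] at hk' b1 b2 b1' b2'
  by_cases h1 : η.coordX s x (qpos q).1 (qpos q).2 (2 * k) =
      η.coordX s x (qpos q').1 (qpos q).2 (2 * k)
  · rw [h1] at h
    obtain ⟨e, he1, he2, he3⟩ := exists_coboundary_ne_zero
      (fun j => η.coordX s x (qpos q').1 j (2 * k)) (by simp [qpos]) (by simp [qpos]) h
    have hlay : η.LayerX x (qpos q').1 e (2 * k) := by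
      refine ⟨b1', ?_, hk', Or.inl ⟨q', hq', Or.inl rfl⟩⟩
      simp only [qpos] at he2
      omega
    refine ⟨hlay.cell, rfl, rfl, ?_⟩
    rw [η.dXX_mulVec s (η.coordX s) (fun c => (η.coordX_coords s c).symm) hlay]
    have e1 : ∀ g, coboundary g (qpos q').1 = 0 := fun g => if_neg (by simp [qpos])
    have e2 : ∀ g, coboundary g (2 * k) = 0 := fun g => if_neg (by omega)
    rwa [e1, e2, zero_add, add_zero]
  · obtain ⟨e, he1, he2, he3⟩ := exists_coboundary_ne_zero
      (fun j => η.coordX s x j (qpos q).2 (2 * k)) (by simp [qpos]) (by simp [qpos]) h1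
    have hlay : η.LayerX x e (qpos q).2 (2 * k) := by
      refine ⟨?_, b2, hk', Or.inl ⟨q, hq, Or.inr rfl⟩⟩
      simp only [qpos] at he2
      omega
    refine ⟨hlay.cell, rfl, rfl, ?_⟩
    rw [η.dXX_mulVec s (η.coordX s) (fun c => (η.coordX_coords s c).symm) hlay]
    have e1 : ∀ g, coboundary g (qpos q).2 = 0 := fun g => if_neg (by simp [qpos])
    have e2 : ∀ g, coboundary g (2 * k) = 0 := fun g => if_neg (by omega)
    rwa [e1, e2, add_zero, add_zero]

/-- The last coordinate of a cell. -/
def heightOf : η.Cell → ℕ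
  | .inl c => c.1.2.2.2
  | .inr (.inl c) => c.2.2
  | .inr (.inr c) => c.1.2.2.2

/-- The qubits of `A` that a cell of a chain can affect: all qubits of `x` for a cell of `C(x)`, the
qubit `q` for a cell of `C(q)`. -/
def shadow : η.Cell → Finset (Fin L × Fin L)
  | .inl c => A.suppX c.1.1
  | .inr (.inl c) => {c.1}
  | .inr (.inr _) => ∅

theorem card_shadow_le (hw : 0 < A.wX) (c : η.Cell) : (η.shadow c).card ≤ A.wX := by
  rcases c with c | c | c
  · exact Finset.le_sup (f := fun x => (A.suppX x).card) (Finset.mem_univ c.1.1)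
  · exact hw
  · exact Nat.zero_le _

/-- The part of the support of a chain at height `k`. -/
def supportAt (l : η.Cell → ZMod 2) (k : ℕ) : Finset η.Cell :=
  Finset.univ.filter fun c => l c ≠ 0 ∧ η.heightOf c = 2 * k

theorem sum_card_supportAt_le (l : η.Cell → ZMod 2) (n : ℕ) :
    ∑ k ∈ Finset.range n, (η.supportAt l k).card ≤ hammingNorm l := by
  classical
  rw [← Finset.card_biUnion]
  · refine Finset.card_le_card fun c hc => ?_
    obtain ⟨k, -, hk⟩ := Finset.mem_biUnion.1 hc
    exact Finset.mem_filter.2 ⟨Finset.mem_univ _, (Finset.mem_filter.1 hk).2.1⟩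
  · intro k _ k' _ hkk
    refine Finset.disjoint_left.2 fun c hc hc' => hkk ?_
    have h1 := (Finset.mem_filter.1 hc).2.2
    have h2 := (Finset.mem_filter.1 hc').2.2
    omega

/-- At every height, the support of a nontrivial cycle of the Layer Code has at least
`d_X(A) / w_X` cells. -/
theorem dX_le_supportAt (P : Matrix η.ZCell η.XCell (ZMod 2))
    (hP : η.totalOf P * η.totalOf P = 0)
    (hPdim : ∀ t s, P t s ≠ 0 → gridDim t.1.2 + gridDim s.1.2 = 1) (hw : 0 < A.wX)
    (hLX : 0 < η.LX) (l : η.Cell → ZMod 2) (hl : ∀ c, l c ≠ 0 → η.deg c = 1)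
    (hl0 : η.totalOf P *ᵥ l = 0) (hne : ¬ ∃ S, η.totalOf P *ᵥ S = l) (k : ℕ) (hk : k < η.LZ) :
    A.dX ≤ ((A.wX * (η.supportAt l k).card : ℕ) : ℕ∞) := by
  classical
  obtain ⟨s, hs, hsl⟩ := η.exists_dXX_eq (l ∘ Sum.inl)
    (by
      intro c hc
      have h1 : 2 - gridDim c.1.2 = 1 := hl _ hc
      omega)
    (by
      rw [← η.elim_components l, totalOf_mulVec] at hl0
      exact (η.elim_eq_zero hl0).1)
  -- the value of `s` at a qubit of `x` at height `k`
  obtain ⟨e, he⟩ : ∃ e : X → ZMod 2, ∀ x, (A.suppX x).Nonempty → ∃ q ∈ A.suppX x,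
      e x = η.coordX s x (qpos q).1 (qpos q).2 (2 * k) := by
    have : ∀ x, ∃ v : ZMod 2, (A.suppX x).Nonempty → ∃ q ∈ A.suppX x,
        v = η.coordX s x (qpos q).1 (qpos q).2 (2 * k) := by
      intro x
      by_cases hx : (A.suppX x).Nonempty
      · obtain ⟨q, hq⟩ := hx
        exact ⟨_, fun _ => ⟨q, hq, rfl⟩⟩
      · exact ⟨0, fun h => absurd h hx⟩
    exact ⟨fun x => (this x).choose, fun x => (this x).choose_spec⟩
  set a : Fin L × Fin L → ZMod 2 := fun q =>
    η.sliceQ (l ∘ Sum.inr ∘ Sum.inl + η.gQX *ᵥ s) q (2 * k) with ha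
  obtain ⟨h1, h2⟩ := η.cycle_of_slices P hP hPdim hLX l hl hl0 hne s hs hsl k hk a fun q => rfl
  set b := a + A.d₂ *ᵥ e with hb
  have hb1 : A.d₁ *ᵥ b = 0 := by
    rw [hb, Matrix.mulVec_add, h1, Matrix.mulVec_mulVec, A.d₁_mul_d₂, Matrix.zero_mulVec, add_zero]
  have hb2 : ¬ ∃ e', A.d₂ *ᵥ e' = b := by
    rintro ⟨e', he'⟩
    refine h2 ⟨e' + e, ?_⟩
    rw [Matrix.mulVec_add, he', hb, add_assoc, add_self_fun, add_zero]
  refine (iInf₂_le b ⟨hb1, hb2⟩).trans ?_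
  have hsub : (Finset.univ.filter fun q => b q ≠ 0) ⊆ (η.supportAt l k).biUnion η.shadow := by
    intro q hq
    have hq' := (Finset.mem_filter.1 hq).2
    rw [hb, Pi.add_apply, ha] at hq'
    simp only at hq'
    rw [sliceQ_add _ _ _ _ _ hk, sliceQ_gQX _ _ _ _ hk, mulVec_d₂, add_assoc,
      ← Finset.sum_add_distrib] at hq'
    rw [Finset.mem_biUnion]
    rcases add_ne_zero_cases hq' with h3 | h3
    · rw [show 2 * k = (η.height k hk).val from rfl, sliceQ_eq_sum] at h3
      obtain ⟨i, -, hi⟩ := Finset.exists_ne_zero_of_sum_ne_zero h3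
      exact ⟨.inr (.inl (q, i, η.height k hk)),
        Finset.mem_filter.2 ⟨Finset.mem_univ _, hi, rfl⟩, Finset.mem_singleton_self q⟩
    · obtain ⟨x, -, hx⟩ := Finset.exists_ne_zero_of_sum_ne_zero h3
      by_cases hqx : q ∈ A.suppX x
      · rw [if_pos hqx, if_pos hqx] at hx
        obtain ⟨q', hq'x, hq'e⟩ := he x ⟨q, hqx⟩
        rw [hq'e] at hx
        obtain ⟨c, rfl, hc2, hc3⟩ := η.exists_edge_of_ne s x k hk hqx hq'x
          fun h => hx (CharTwo.add_eq_zero.2 h)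
        rw [hsl] at hc3
        exact ⟨.inl c, Finset.mem_filter.2 ⟨Finset.mem_univ _, hc3, hc2⟩, hqx⟩
      · rw [if_neg hqx, if_neg hqx, add_zero] at hx
        exact absurd rfl hx
  have hcard : hammingNorm b ≤ A.wX * (η.supportAt l k).card := by
    rw [mul_comm]
    exact (Finset.card_le_card hsub).trans
      (Finset.card_biUnion_le_card_mul _ _ _ fun c _ => η.card_shadow_le hw c)
  exact_mod_cast hcard

theorem mul_dX_le_hammingNorm (P : Matrix η.ZCell η.XCell (ZMod 2))
    (hP : η.totalOf P * η.totalOf P = 0)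
    (hPdim : ∀ t s, P t s ≠ 0 → gridDim t.1.2 + gridDim s.1.2 = 1) (hw : 0 < A.wX)
    (hLX : 0 < η.LX) (l : η.Cell → ZMod 2) (hl : ∀ c, l c ≠ 0 → η.deg c = 1)
    (hl0 : η.totalOf P *ᵥ l = 0) (hne : ¬ ∃ S, η.totalOf P *ᵥ S = l) :
    (η.LZ : ℕ∞) * A.dX ≤ ((A.wX * hammingNorm l : ℕ) : ℕ∞) := by
  have h1 : (η.LZ : ℕ∞) * A.dX = ∑ _k ∈ Finset.range η.LZ, A.dX := by simp
  rw [h1]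
  refine (Finset.sum_le_sum fun k hk => η.dX_le_supportAt P hP hPdim hw hLX l hl hl0 hne k
    (Finset.mem_range.1 hk)).trans ?_
  rw [← Nat.cast_sum, ← Finset.mul_sum]
  exact_mod_cast Nat.mul_le_mul_left _ (η.sum_card_supportAt_le l _)

end Coloring

end Layers

section Layers

variable {L : ℕ} {X Z : Type*} [Fintype X] [Fintype Z] [DecidableEq X] [DecidableEq Z]
  {A : CSSComplex X (Fin L × Fin L) Z} {χX χZ : ℕ}

namespace Coloring

variable (η : Coloring A χX χZ)

/-! ### The distances of the Layer Code -/

theorem le_LX : L ≤ η.LX := le_max_right _ _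

theorem le_LZ : L ≤ η.LZ := le_max_right _ _

theorem size_pos_of_wX_pos (hw : 0 < A.wX) : 0 < L := by
  obtain ⟨x, -, hx⟩ := Finset.lt_sup_iff.1 hw
  obtain ⟨q, -⟩ := Finset.card_pos.1 hx
  exact (Nat.zero_le _).trans_lt q.1.2

theorem pZX_grading (t : η.ZCell) (s : η.XCell) (h : η.pZX t s ≠ 0) :
    gridDim t.1.2 + gridDim s.1.2 = 1 := by
  have h1 : η.deg (.inl s) = η.deg (.inr (.inr t)) + 1 :=
    η.deg_of_totalD_ne_zero (show η.totalD (.inr (.inr t)) (.inl s) ≠ 0 from h)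
  simp only [deg] at h1
  omega

theorem mul_dX_le_dX (hw : 0 < A.wX) (l : η.CellOf 1 → ZMod 2) (hl : η.code.d₁ *ᵥ l = 0)
    (hne : ¬ ∃ s, η.code.d₂ *ᵥ s = l) :
    (η.LZ : ℕ∞) * A.dX ≤ ((A.wX * hammingNorm l : ℕ) : ℕ∞) := by
  rw [← hammingNorm_extendZero (fun c => η.deg c = 1) l]
  refine η.mul_dX_le_hammingNorm η.pZX η.totalD_mul_totalD η.pZX_grading hw
    ((size_pos_of_wX_pos hw).trans_le η.le_LX) _ (fun c => of_extendZero_ne_zero) ?_ ?_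
  · refine mulVec_extendZero_eq_zero η.totalD (fun c => η.deg c = 1) (fun c => η.deg c = 0) ?_ l hl
    intro t s h hs
    have := η.deg_of_totalD_ne_zero h
    omega
  · rintro ⟨S, hS⟩
    refine hne ⟨_, submatrix_mulVec_eq η.totalD (fun c => η.deg c = 1) (fun c => η.deg c = 2) ?_ l S
      hS⟩
    intro t s h ht
    have := η.deg_of_totalD_ne_zero h
    omega

/-- The cells of the Layer Code of the transposed code. -/
def swap : η.Cell ≃ η.transpose.Cell where
  toFun
    | .inl c => .inr (.inr (η.swapX c))
    | .inr (.inl c) => .inr (.inl (η.swapQ c))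
    | .inr (.inr c) => .inl (η.swapZ c)
  invFun
    | .inl c => .inr (.inr (η.swapZ.symm c))
    | .inr (.inl c) => .inr (.inl (η.swapQ.symm c))
    | .inr (.inr c) => .inl (η.swapX.symm c)
  left_inv := by rintro (c | c | c) <;> rfl
  right_inv := by rintro (c | c | c) <;> rfl

/-- The transposed defect map. Its paths are traversed backwards, so it is not the defect map of the
transposed code. -/
def transposeDefect : Matrix η.transpose.ZCell η.transpose.XCell (ZMod 2) :=
  Matrix.of fun t s => η.pZX (η.swapZ.symm s) (η.swapX.symm t)

theorem totalD_transpose :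
    η.totalDᵀ = (η.transpose.totalOf η.transposeDefect).submatrix η.swap η.swap := by
  ext (t | t | t) (s | s | s)
  · exact (η.dZZ_swapX t s).symm
  · exact (η.gZQ_swap s t).symm
  · rfl
  · rfl
  · exact (η.dQQ_swapQ t s).symm
  · exact (η.gQX_swap s t).symm
  · rfl
  · rfl
  · exact (η.dXX_swapZ t s).symm

theorem deg_swap (c : η.Cell) (h : η.deg c = 1) : η.transpose.deg (η.swap c) = 1 := by
  rcases c with c | ⟨q, i, k⟩ | c
  · have h1 : 2 - gridDim c.1.2 = 1 := h
    refine (η.gridDim_swapX c).trans ?_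
    omega
  · have h1 : rdim i + (1 - rdim k) = 1 := h
    have h2 : rdim k + (1 - rdim i) = 1 := by
      have := rdim_le i
      have := rdim_le k
      omega
    exact h2
  · have h1 : gridDim c.1.2 = 1 := h
    have h2 : 2 - gridDim (η.swapZ c).1.2 = 1 := by rw [η.gridDim_swapZ c, h1]
    exact h2

theorem totalOf_transposeDefect_mul_self :
    η.transpose.totalOf η.transposeDefect * η.transpose.totalOf η.transposeDefect = 0 := by
  have h : η.transpose.totalOf η.transposeDefect =
      η.totalDᵀ.submatrix η.swap.symm η.swap.symm := by
    rw [totalD_transpose]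
    ext t s
    simp
  rw [h, Matrix.submatrix_mul_equiv, ← Matrix.transpose_mul, totalD_mul_totalD]
  rfl

theorem transposeDefect_grading (t : η.transpose.ZCell) (s : η.transpose.XCell)
    (h : η.transposeDefect t s ≠ 0) : gridDim t.1.2 + gridDim s.1.2 = 1 := by
  have h1 := η.pZX_grading _ _ h
  rw [← gridDim_swapX, ← gridDim_swapZ, Equiv.apply_symm_apply, Equiv.apply_symm_apply] at h1
  omega

theorem hammingNorm_comp_equiv {α β : Type*} [Fintype α] [Fintype β] (e : α ≃ β) (f : α → ZMod 2) :
    hammingNorm (f ∘ e.symm) = hammingNorm f :=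
  Finset.card_equiv e.symm fun c => by simp

theorem mul_dZ_le_dZ (hw : 0 < A.wZ) (l : η.CellOf 1 → ZMod 2) (hl : η.code.d₂ᵀ *ᵥ l = 0)
    (hne : ¬ ∃ s, η.code.d₁ᵀ *ᵥ s = l) :
    (η.LX : ℕ∞) * A.dZ ≤ ((A.wZ * hammingNorm l : ℕ) : ℕ∞) := by
  set f := extendZero (fun c => η.deg c = 1) l with hf
  rw [← hammingNorm_extendZero (fun c => η.deg c = 1) l, ← hf, ← hammingNorm_comp_equiv η.swap]
  have hw' : 0 < A.transpose.wX := hw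
  refine η.transpose.mul_dX_le_hammingNorm η.transposeDefect η.totalOf_transposeDefect_mul_self
    η.transposeDefect_grading hw' ((size_pos_of_wX_pos hw').trans_le η.transpose.le_LX) _ ?_ ?_ ?_
  · intro c hc
    rw [← η.swap.apply_symm_apply c]
    exact η.deg_swap _ (of_extendZero_ne_zero (p := fun c => η.deg c = 1) (l := l) hc)
  · have h1 : η.totalDᵀ *ᵥ f = 0 := by
      refine mulVec_extendZero_eq_zero η.totalDᵀ (fun c => η.deg c = 1) (fun c => η.deg c = 2) ?_ l
        hl
      intro t s h hs
      have := η.deg_of_totalD_ne_zero h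
      omega
    rw [totalD_transpose, Matrix.submatrix_mulVec_equiv] at h1
    ext c
    simpa using congrFun h1 (η.swap.symm c)
  · rintro ⟨S, hS⟩
    refine hne ⟨_, submatrix_mulVec_eq η.totalDᵀ (fun c => η.deg c = 1) (fun c => η.deg c = 0) ?_ l
      (S ∘ η.swap) ?_⟩
    · intro t s h ht
      have := η.deg_of_totalD_ne_zero h
      omega
    · rw [totalD_transpose, Matrix.submatrix_mulVec_equiv, Function.comp_assoc,
        Equiv.self_comp_symm, Function.comp_id, hS, Function.comp_assoc, Equiv.symm_comp_self,
        Function.comp_id]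

theorem mul_le_of_nat_mul_le {n w N : ℕ} {d : ℕ∞} (hw : 0 < w)
    (h : (n : ℕ∞) * d ≤ ((w * N : ℕ) : ℕ∞)) :
    ((n / w : ℝ≥0) : ℝ≥0∞) * (d : ℝ≥0∞) ≤ ((N : ℕ∞) : ℝ≥0∞) := by
  have h1 : (n : ℝ≥0∞) * (d : ℝ≥0∞) ≤ (w : ℝ≥0∞) * (N : ℝ≥0∞) := by
    have := ENat.toENNReal_le.2 h
    simpa using this
  rw [ENNReal.coe_div (by positivity), ENNReal.coe_natCast, ENNReal.coe_natCast, ENat.toENNReal_coe,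
    div_eq_mul_inv, mul_right_comm, ← div_eq_mul_inv]
  exact ENNReal.div_le_of_le_mul' h1

/-- The `X`-distance of the Layer Code is at least `L_Z / w_X` times that of `A`. -/
theorem div_mul_dX_le (hw : 0 < A.wX) :
    ((η.LZ / A.wX : ℝ≥0) : ℝ≥0∞) * (A.dX : ℝ≥0∞) ≤ (η.code.dX : ℝ≥0∞) := by
  rw [CSSComplex.dX.eq_def (A := η.code)]
  simp only [ENat.toENNReal_iInf]
  exact le_iInf₂ fun l hl => mul_le_of_nat_mul_le hw (η.mul_dX_le_dX hw l hl.1 hl.2)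

/-- The `Z`-distance of the Layer Code is at least `L_X / w_Z` times that of `A`. -/
theorem div_mul_dZ_le (hw : 0 < A.wZ) :
    ((η.LX / A.wZ : ℝ≥0) : ℝ≥0∞) * (A.dZ : ℝ≥0∞) ≤ (η.code.dZ : ℝ≥0∞) := by
  rw [CSSComplex.dZ.eq_def (A := η.code)]
  simp only [ENat.toENNReal_iInf]
  exact le_iInf₂ fun l hl => mul_le_of_nat_mul_le hw (η.mul_dZ_le_dZ hw l hl.1 hl.2)

end Coloring

end Layers

/-- Decreasing the factor of a distance bound. -/
theorem mul_le_of_le_factor {c c' : ℝ≥0} (h : c ≤ c') {d e : ℝ≥0∞} (hb : (c' : ℝ≥0∞) * d ≤ e) :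
    (c : ℝ≥0∞) * d ≤ e :=
  (mul_le_mul_left (ENNReal.coe_le_coe.2 h) d).trans hb

/-- Enlarging the denominator by factors that are natural numbers decreases a quotient, also if
these factors vanish, as division by zero gives zero. -/
theorem div_mul_mul_le (a b : ℝ≥0) (m n : ℕ) : a / (b * m * n) ≤ a / b := by
  rw [mul_assoc, ← div_div, ← Nat.cast_mul]
  rcases Nat.eq_zero_or_pos (m * n) with h | h
  · rw [h, Nat.cast_zero, div_zero]
    exact zero_le
  · exact div_le_self zero_le (by exact_mod_cast h)

end LayerCode

theorem theorem2 :
    -- 4D Layer Codes of `A` exist, with any numbers of line colours above the order `w q L`.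
    (∃ K₀ : ℝ≥0, ∀ (L : ℕ) (X : Type u) (Z : Type v) [Fintype X] [Fintype Z]
      (A : CSSComplex X (Fin L × Fin L) Z),
      (∀ x, (A.suppX x).Nonempty) → (∀ z, (A.suppZ z).Nonempty) →
      ∀ χX χZ : ℕ, K₀ * A.wX * A.qX * L ≤ χX → K₀ * A.wZ * A.qZ * L ≤ χZ →
        Nonempty (LayerCode.Coloring A χX χZ)) ∧
    -- The distance bounds.
    (∀ K : ℝ≥0, ∃ c : ℝ≥0, 0 < c ∧
      ∀ (L : ℕ) (X : Type u) (Z : Type v) [Fintype X] [Fintype Z] [DecidableEq X] [DecidableEq Z]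
        (A : CSSComplex X (Fin L × Fin L) Z), 0 < A.wX → 0 < A.wZ →
      ∀ (χX χZ : ℕ) (η : LayerCode.Coloring A χX χZ),
        χX ≤ K * A.wX * A.qX * L → χZ ≤ K * A.wZ * A.qZ * L →
        ((c * (η.LZ / (A.wX * A.wZ * A.qZ)) : ℝ≥0) : ℝ≥0∞) * (A.dX : ℝ≥0∞)
            ≤ (η.code.dX : ℝ≥0∞) ∧
        ((c * (η.LX / (A.wZ * A.wX * A.qX)) : ℝ≥0) : ℝ≥0∞) * (A.dZ : ℝ≥0∞)
            ≤ (η.code.dZ : ℝ≥0∞)) ∧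
    -- The distance bounds for boosted side lengths.
    (∀ κ K : ℝ≥0, 0 < κ → ∃ c : ℝ≥0, 0 < c ∧
      ∀ (L : ℕ) (X : Type u) (Z : Type v) [Fintype X] [Fintype Z] [DecidableEq X] [DecidableEq Z]
        (A : CSSComplex X (Fin L × Fin L) Z), 0 < A.wX → 0 < A.wZ →
      ∀ (χX χZ : ℕ) (η : LayerCode.Coloring A χX χZ),
        κ * A.wX * A.qX * L ≤ η.LX → η.LX ≤ K * A.w * A.q * L →
        κ * A.wZ * A.qZ * L ≤ η.LZ → η.LZ ≤ K * A.w * A.q * L →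
        ((c * (L / A.wX) : ℝ≥0) : ℝ≥0∞) * (A.dX : ℝ≥0∞) ≤ (η.code.dX : ℝ≥0∞) ∧
        ((c * (L / A.wZ) : ℝ≥0) : ℝ≥0∞) * (A.dZ : ℝ≥0∞) ≤ (η.code.dZ : ℝ≥0∞) ∧
        ((c * (L / A.w) : ℝ≥0) : ℝ≥0∞) * (A.dist : ℝ≥0∞) ≤ (η.code.dist : ℝ≥0∞)) := by
  refine ⟨⟨3, ?_⟩, fun K => ⟨1, one_pos, ?_⟩, fun κ K _ => ⟨1, one_pos, ?_⟩⟩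
  · intro L X Z _ _ A hX hZ χX χZ h1 h2
    exact LayerCode.exists_coloring A hX hZ χX χZ (by exact_mod_cast h1) (by exact_mod_cast h2)
  · intro L X Z _ _ _ _ A hwX hwZ χX χZ η _ _
    rw [one_mul, one_mul]
    exact ⟨LayerCode.mul_le_of_le_factor (LayerCode.div_mul_mul_le _ _ _ _) (η.div_mul_dX_le hwX),
      LayerCode.mul_le_of_le_factor (LayerCode.div_mul_mul_le _ _ _ _) (η.div_mul_dZ_le hwZ)⟩
  · intro L X Z _ _ _ _ A hwX hwZ χX χZ η _ _ _ _
    simp only [one_mul]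
    have hLX : (L : ℝ≥0) ≤ η.LX := by exact_mod_cast η.le_LX
    have hLZ : (L : ℝ≥0) ≤ η.LZ := by exact_mod_cast η.le_LZ
    have hX := LayerCode.mul_le_of_le_factor
      (div_le_div_of_nonneg_right hLZ zero_le) (η.div_mul_dX_le hwX)
    have hZ := LayerCode.mul_le_of_le_factor
      (div_le_div_of_nonneg_right hLX zero_le) (η.div_mul_dZ_le hwZ)
    refine ⟨hX, hZ, ?_⟩
    have hwX' : (0 : ℝ≥0) < A.wX := by exact_mod_cast hwX
    have hwZ' : (0 : ℝ≥0) < A.wZ := by exact_mod_cast hwZ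
    have hX' := LayerCode.mul_le_of_le_factor (div_le_div_of_nonneg_left zero_le hwX'
      (show (A.wX : ℝ≥0) ≤ A.w by exact_mod_cast le_max_left _ _)) hX
    have hZ' := LayerCode.mul_le_of_le_factor (div_le_div_of_nonneg_left zero_le hwZ'
      (show (A.wZ : ℝ≥0) ≤ A.w by exact_mod_cast le_max_right _ _)) hZ
    have hdX : (A.dist : ℝ≥0∞) ≤ A.dX := ENat.toENNReal_le.2 (min_le_left _ _)
    have hdZ : (A.dist : ℝ≥0∞) ≤ A.dZ := ENat.toENNReal_le.2 (min_le_right _ _)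
    rcases min_choice η.code.dX η.code.dZ with h | h
    · rw [CSSComplex.dist.eq_def (A := η.code), h]
      exact (mul_le_mul_right hdX _).trans hX'
    · rw [CSSComplex.dist.eq_def (A := η.code), h]
      exact (mul_le_mul_right hdZ _).trans hZ'
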